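/- Let $N_A,N_B\ge 0$, $N=N_A+N_B$, and let $\rho_{AB}$ be a quantum state (positive semidefinite, trace one) of $N$ qubits divided into a part $A$ of $N_A$ qubits and a part $B$ of $N_B$ qubits. Let $$X_4=\mathrm{Tr}\big(\mathcal S\,\rho_{AB}^{\otimes 4}\big),\qquad \mathcal S=\mathbb S^{(A)}_{14}\otimes\mathbb S^{(A)}_{23}\otimes\mathbb S^{(B)}_{12}\otimes\mathbb S^{(B)}_{34},$$ where $\mathbb S^{(X)}_{kl}$ swaps the $X$-parts of the $k$-th and the $l$-th of the four copies. Let $M\ge 1$ be divisible by $4$. In each of $M$ independent runs, on fresh copies of $\rho_{AB}$, every qubit $i$ is measured in a basis $\mathcal B_i$ chosen uniformly and independently among the three Pauli bases $\mathcal X,\mathcal Y,\mathcal Z$, with outcome $s_i\in\{\pm\}$ distributed by the Born rule, and the Pauli shadow of run $r$ is $\hat\rho^{(r)}=\bigotimes_{i=1}^N\big(3|\mathcal B_i,s_i\rangle\langle \mathcal B_i,s_i|-\mathbb I_2\big)$. The batch shadows and the four-batch estimator are $$\tilde\rho^{(b)}=\frac4M\sum_{r=(b-1)M/4+1}^{bM/4}\hat\rho^{(r)}\quad(b=1,\dots,4),\qquad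 \tilde X_4^{(4)}=\frac1{4!}\sum_{b_1,\dots,b_4\ \text{distinct}}\mathrm{Tr}\Big[\mathcal S\bigotimes_{i=1}^4\tilde\rho^{(b_i)}\Big].$$ Then $\tilde X_4^{(4)}$ is square integrable and $$\mathrm{Var}\big[\tilde X_4^{(4)}\big]\le\Big(1+4\,\frac{3^N}{M}\Big)^4-1 .$$ Moreover, for all $\epsilon,\delta>0$, if $$M\ \ge\ \frac{4\cdot 3^N}{(1+\epsilon^2\delta)^{1/4}-1},$$ then $\Pr\big[|\tilde X_4^{(4)}-X_4|\ge\epsilon\big]\le\delta$. The right-hand side of the condition on $M$ is at least $16\cdot 3^N/(\epsilon^2\delta)$ for all $\epsilon,\delta>0$, and for fixed $N$ it is asymptotically equivalent to $16\cdot 3^N/(\epsilon^2\delta)$ as $\epsilon^2\delta\to0^+$. -/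

import Mathlib

open scoped Kronecker ComplexOrder
open MeasureTheory ProbabilityTheory

namespace BatchShadow

/-- Labels of the computational basis of a register of `n` qubits. -/
abbrev Bits (n : ℕ) : Type := Fin n → Fin 2

/-- Labels of the computational basis of the bipartite system `AB`. -/
abbrev BitsAB (NA NB : ℕ) : Type := Bits NA × Bits NB

/-- The tensor product `⨂ i, T i` of a finite family of matrices. -/
def tensor {ι κ : Type*} [Fintype ι] (T : ι → Matrix κ κ ℂ) : Matrix (ι → κ) (ι → κ) ℂ :=
  Matrix.of fun x y => ∏ i, T i (x i) (y i)

/-- A quantum state: a positive semidefinite matrix of unit trace. -/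
structure IsDensityMatrix {κ : Type*} [Fintype κ] (ρ : Matrix κ κ ℂ) : Prop where
  posSemidef : ρ.PosSemidef
  trace_eq_one : ρ.trace = 1

/-! ### The functional `X₄` -/

/-- The linear operator with `|y⟩ ↦ |f y⟩` on basis vectors. -/
def basisMap {κ : Type*} [DecidableEq κ] (f : κ → κ) : Matrix κ κ ℂ :=
  Matrix.of fun x y => if x = f y then 1 else 0

/-- The swap operator of the `A` parts of copies `k` and `l` of the system `AB`, acting on four
copies (the identity on all other tensor factors). -/
def swapA (NA NB : ℕ) (k l : Fin 4) :
    Matrix (Fin 4 → BitsAB NA NB) (Fin 4 → BitsAB NA NB) ℂ :=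
  basisMap fun y c => ((y (Equiv.swap k l c)).1, (y c).2)

/-- The swap operator of the `B` parts of copies `k` and `l` of the system `AB`, acting on four
copies (the identity on all other tensor factors). -/
def swapB (NA NB : ℕ) (k l : Fin 4) :
    Matrix (Fin 4 → BitsAB NA NB) (Fin 4 → BitsAB NA NB) ℂ :=
  basisMap fun y c => ((y c).1, (y (Equiv.swap k l c)).2)

/-- The four-copy operator `S^(A)_{14} ⊗ S^(A)_{23} ⊗ S^(B)_{12} ⊗ S^(B)_{34}`; the four copies are
numbered `0, 1, 2, 3`, and the four factors act on pairwise disjoint tensor factors. -/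
def opS (NA NB : ℕ) : Matrix (Fin 4 → BitsAB NA NB) (Fin 4 → BitsAB NA NB) ℂ :=
  swapA NA NB 0 3 * swapA NA NB 1 2 * swapB NA NB 0 1 * swapB NA NB 2 3

/-- `X₄ = Tr (𝒮 ρ^{⊗4})`. For Hermitian `ρ` this trace is real, see `coe_X4`. -/
noncomputable def X4 {NA NB : ℕ} (ρ : Matrix (BitsAB NA NB) (BitsAB NA NB) ℂ) : ℝ :=
  (Matrix.trace (opS NA NB * tensor fun _ : Fin 4 => ρ)).re

/-! ### Pauli shadows -/

/-- The three single-qubit measurement bases. -/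
inductive PauliBasis where
  | X
  | Y
  | Z
  deriving DecidableEq

instance : Fintype PauliBasis where
  elems := {.X, .Y, .Z}
  complete := by intro b; cases b <;> simp

instance : MeasurableSpace PauliBasis := ⊤

instance : DiscreteMeasurableSpace PauliBasis := ⟨fun _ => trivial⟩

/-- The state vector `|𝓑, s⟩`; the sign `+` is `true` and the sign `-` is `false`. -/
noncomputable def ket : PauliBasis × Bool → Fin 2 → ℂ
  | (.Z, true) => ![1, 0]
  | (.Z, false) => ![0, 1]
  | (.X, true) => ![1 / (√2 : ℝ), 1 / (√2 : ℝ)]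
  | (.X, false) => ![1 / (√2 : ℝ), -1 / (√2 : ℝ)]
  | (.Y, true) => ![1 / (√2 : ℝ), Complex.I / (√2 : ℝ)]
  | (.Y, false) => ![1 / (√2 : ℝ), -Complex.I / (√2 : ℝ)]

/-- The projector `|𝓑, s⟩⟨𝓑, s|`. -/
noncomputable def proj (d : PauliBasis × Bool) : Matrix (Fin 2) (Fin 2) ℂ :=
  Matrix.of fun i j => ket d i * star (ket d j)

/-- The classical record of one run: for each qubit of `A` and of `B`, the measured Pauli basis and
the sign that was observed. -/
abbrev Record (NA NB : ℕ) : Type :=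
  (Fin NA → PauliBasis × Bool) × (Fin NB → PauliBasis × Bool)

/-- The product projector `⨂ i, |𝓑ᵢ, sᵢ⟩⟨𝓑ᵢ, sᵢ|` of a record. -/
noncomputable def recordProj {NA NB : ℕ} (d : Record NA NB) :
    Matrix (BitsAB NA NB) (BitsAB NA NB) ℂ :=
  (tensor fun i => proj (d.1 i)) ⊗ₖ (tensor fun j => proj (d.2 j))

/-- The probability of a record when each qubit of `ρ` is measured in a basis chosen uniformly and
independently among the three Pauli bases (Born rule). -/
noncomputable def recordProb {NA NB : ℕ} (ρ : Matrix (BitsAB NA NB) (BitsAB NA NB) ℂ)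
    (d : Record NA NB) : ℝ :=
  (1 / 3) ^ (NA + NB) * (Matrix.trace (ρ * recordProj d)).re

/-- The Pauli shadow `⨂ i, (3 |𝓑ᵢ, sᵢ⟩⟨𝓑ᵢ, sᵢ| - 𝟙)` of a record. -/
noncomputable def shadow {NA NB : ℕ} (d : Record NA NB) :
    Matrix (BitsAB NA NB) (BitsAB NA NB) ℂ :=
  (tensor fun i => (3 : ℂ) • proj (d.1 i) - 1) ⊗ₖ (tensor fun j => (3 : ℂ) • proj (d.2 j) - 1)

/-- `D 0, …, D (M - 1)` are the random records of `M` independent runs of the randomized Pauli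
measurement, each on a fresh copy of the state `ρ`. -/
structure IsPauliSample {NA NB M : ℕ} (ρ : Matrix (BitsAB NA NB) (BitsAB NA NB) ℂ)
    {Ω : Type*} [MeasurableSpace Ω] (μ : Measure Ω) (D : Fin M → Ω → Record NA NB) : Prop where
  measurable : ∀ r, Measurable (D r)
  indep : iIndepFun D μ
  law : ∀ r d, μ.real {ω | D r ω = d} = recordProb ρ d

/-! ### The four-batch estimator -/

/-- The `b`-th batch shadow: `4 / M` times the sum of the shadows with index in the `b`-th of the
four consecutive blocks of length `M / 4` (used when `4 ∣ M`). -/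
noncomputable def batch {NA NB M : ℕ} (d : Fin M → Record NA NB) (b : Fin 4) :
    Matrix (BitsAB NA NB) (BitsAB NA NB) ℂ :=
  ((4 : ℂ) / (M : ℂ)) •
    ∑ t : Fin M with b.val * (M / 4) ≤ t.val ∧ t.val < (b.val + 1) * (M / 4), shadow (d t)

/-- The batch shadow estimator of `X₄` with four batches: the average of `Tr (𝒮 ⨂ i, ρ̃^(b i))` over
the `4!` tuples `(b 0, …, b 3)` of distinct batches. The trace is real, see `coe_X4est`. -/
noncomputable def X4est {NA NB M : ℕ} (d : Fin M → Record NA NB) : ℝ :=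
  (1 / (Nat.factorial 4 : ℝ)) * ∑ b : Equiv.Perm (Fin 4),
    (Matrix.trace (opS NA NB * tensor fun i => batch d (b i))).re

/-! ### The traces above are real -/

theorem basisMap_mul {κ : Type*} [Fintype κ] [DecidableEq κ] (f g : κ → κ) :
    basisMap f * basisMap g = basisMap (f ∘ g) := by
  ext x y
  simp [basisMap, Matrix.mul_apply]

theorem basisMap_isHermitian {κ : Type*} [DecidableEq κ] {f : κ → κ}
    (hf : Function.Involutive f) : (basisMap f).IsHermitian := by
  ext x y
  simp only [basisMap, Matrix.conjTranspose_apply, Matrix.of_apply]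
  have h : y = f x ↔ x = f y :=
    ⟨fun h => by rw [h, hf x], fun h => by rw [h, hf y]⟩
  by_cases hx : x = f y
  · simp [h, ← hx]
  · simp [h, hx]

theorem opS_isHermitian (NA NB : ℕ) : (opS NA NB).IsHermitian := by
  unfold opS swapA swapB
  rw [basisMap_mul, basisMap_mul, basisMap_mul]
  apply basisMap_isHermitian
  intro y
  funext c
  fin_cases c <;> rfl

theorem tensor_isHermitian {ι κ : Type*} [Fintype ι] {T : ι → Matrix κ κ ℂ}
    (h : ∀ i, (T i).IsHermitian) : (tensor T).IsHermitian := by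
  ext x y
  simp only [tensor, Matrix.conjTranspose_apply, Matrix.of_apply, star_prod]
  exact Finset.prod_congr rfl fun i _ => (h i).apply (x i) (y i)

theorem trace_mul_re {κ : Type*} [Fintype κ] {P Q : Matrix κ κ ℂ} (hP : P.IsHermitian)
    (hQ : Q.IsHermitian) : (((P * Q).trace.re : ℝ) : ℂ) = (P * Q).trace := by
  apply Complex.conj_eq_iff_re.mp
  change star (P * Q).trace = (P * Q).trace
  rw [← Matrix.trace_conjTranspose, Matrix.conjTranspose_mul, hP.eq, hQ.eq, Matrix.trace_mul_comm]

theorem coe_X4 {NA NB : ℕ} {ρ : Matrix (BitsAB NA NB) (BitsAB NA NB) ℂ} (hρ : ρ.IsHermitian) :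
    (X4 ρ : ℂ) = Matrix.trace (opS NA NB * tensor fun _ : Fin 4 => ρ) :=
  trace_mul_re (opS_isHermitian NA NB) (tensor_isHermitian fun _ => hρ)

theorem shadow_isHermitian {NA NB : ℕ} (d : Record NA NB) : (shadow d).IsHermitian := by
  have hp : ∀ e : PauliBasis × Bool, ((3 : ℂ) • proj e - 1).IsHermitian := by
    intro e
    refine Matrix.IsHermitian.sub ?_ Matrix.isHermitian_one
    ext x y
    simp [proj, mul_comm]
  unfold shadow
  rw [Matrix.IsHermitian, Matrix.conjTranspose_kronecker,
    (tensor_isHermitian fun i => hp (d.1 i)).eq, (tensor_isHermitian fun j => hp (d.2 j)).eq]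

theorem batch_isHermitian {NA NB M : ℕ} (d : Fin M → Record NA NB) (b : Fin 4) :
    (batch d b).IsHermitian := by
  unfold batch
  rw [Matrix.IsHermitian, Matrix.conjTranspose_smul, Matrix.conjTranspose_sum]
  congr 1
  · simp
  · exact Finset.sum_congr rfl fun t _ => (shadow_isHermitian (d t)).eq

theorem coe_X4est {NA NB M : ℕ} (d : Fin M → Record NA NB) :
    (X4est d : ℂ) = (1 / (Nat.factorial 4 : ℂ)) * ∑ b : Equiv.Perm (Fin 4),
      Matrix.trace (opS NA NB * tensor fun i => batch d (b i)) := by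
  unfold X4est
  push_cast
  congr 1
  exact Finset.sum_congr rfl fun b _ => trace_mul_re (opS_isHermitian NA NB)
    (tensor_isHermitian fun i => batch_isHermitian d (b i))

end BatchShadow

/-!
Write `K = M / 4` and `N = NA + NB`. The estimator is a symmetric real multilinear form in the four
batch shadows (`symmTraceForm`), which are independent means of `K` independent shadows. Since
shadows are unbiased (`sum_recordProb_smul_shadow`), the form has expectation `X₄`. Second moments
of linear functionals of a batch agree with those of a mixture: a fresh shadow with weight `1 / K`,
the state `ρ` itself with weight `1 - 1 / K`. Applied in each slot, this writes the second moment of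
the estimator as a sum over sets `T` of slots (`sum_sq_multilinear_batch`), in which the slots in
`T` hold independent shadows and the others hold `ρ`. The empty set contributes at most `X₄ ^ 2`,
so the variance bound follows once the second moment for each nonempty `T` is at most
`3 ^ (N * |T|)`.

For that bound, realign an operator on `AB` to a matrix whose rows carry the indices of `A` and
whose columns carry the indices of `B`. The trace with `𝒮` becomes the cyclic trace
`Tr (M₀ M₁ᴴ M₂ M₃ᴴ)` (`trace_opS_mul_tensor`). The realignment of a shadow has rank one, so the
shadows cut the cycle into segments and the trace is the product of the values of the segments. Each
segment has a majorant that depends only on the measurement bases at its two ends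
(`BasisAverageBounded`).
* If no `ρ` lies in between, the value is the overlap of two shadows. Its square is at most `25` per
  qubit for equal bases and `1 / 4` for different ones, on average `17 / 2 ≤ 9`.
* Otherwise it is a bilinear form with a matrix that is a product of realignments of `ρ` and their
  adjoints. The Frobenius norm of this matrix is at most one. The single-qubit shadows satisfy a
  Bessel inequality with constant `9`, which passes to tensor products (`sum_normSq_shadowVec_le`).
  The sum over all signs, averaged over the bases, is therefore at most `9 / 3` per qubit and end.

Either way the majorant averages to at most `3` per qubit and end of the segment. The bases are
uniform and independent whatever the state is, and the segments have no registers in common, so the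
averages multiply to `3 ^ (N * |T|)`. The bound on the number of measurements is Chebyshev's
inequality, and its comparison with `16 * 3 ^ N / (ε ^ 2 * δ)` is Bernoulli's inequality and the
derivative of `(1 + x) ^ (1 / 4)` at zero.
-/

namespace BatchShadow

/-! ### Weighted sums over independent copies -/

theorem sum_fin_succ_pi {n : ℕ} {Z R : Type*} [Fintype Z] [AddCommMonoid R]
    (F : (Fin (n + 1) → Z) → R) :
    ∑ z, F z = ∑ z₀, ∑ z : Fin n → Z, F (Fin.cons z₀ z) := by
  rw [← (Fin.consEquiv fun _ : Fin (n + 1) => Z).sum_comp, Fintype.sum_prod_type]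
  rfl

theorem multilinear_cons {E Y : Type*} [AddCommGroup E] [Module ℝ E] {n : ℕ}
    (B : MultilinearMap ℝ (fun _ : Fin (n + 1) => E) ℝ) (U : Y → E) (z₀ : Y) (z : Fin n → Y) :
    B (fun i => U ((Fin.cons z₀ z : Fin (n + 1) → Y) i))
      = B.curryLeft (U z₀) (fun i => U (z i)) := by
  rw [MultilinearMap.curryLeft_apply]
  congr 1
  funext i
  refine Fin.cases ?_ (fun j => ?_) i <;> simp

/-- The `k`-th moment of a multilinear form in independent random vectors depends only on the
`k`-th moments of the linear functionals of each vector: a weighted family `(W, V)` may be replaced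
by any other one with the same `k`-th moments. -/
theorem sum_pow_multilinear_congr {E Z Z' : Type*} [AddCommGroup E] [Module ℝ E] [Fintype Z]
    [Fintype Z'] {W : Z → ℝ} {V : Z → E} {W' : Z' → ℝ} {V' : Z' → E} {k : ℕ}
    (h : ∀ ℓ : E →ₗ[ℝ] ℝ, ∑ z, W z * ℓ (V z) ^ k = ∑ z, W' z * ℓ (V' z) ^ k) {n : ℕ}
    (B : MultilinearMap ℝ (fun _ : Fin n => E) ℝ) :
    ∑ z : Fin n → Z, (∏ i, W (z i)) * B (fun i => V (z i)) ^ k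
      = ∑ z : Fin n → Z', (∏ i, W' (z i)) * B (fun i => V' (z i)) ^ k := by
  induction n with
  | zero =>
    have hV (z : Fin 0 → Z) : (fun i => V (z i)) = 0 := Subsingleton.elim _ _
    have hV' (z : Fin 0 → Z') : (fun i => V' (z i)) = 0 := Subsingleton.elim _ _
    simp [hV, hV']
  | succ n ih =>
    have lin (w : Fin n → E) : ∑ z, W z * B.curryLeft (V z) w ^ k
        = ∑ z, W' z * B.curryLeft (V' z) w ^ k :=
      h { toFun := fun x => B.curryLeft x w
          map_add' := fun x y => by simp
          map_smul' := fun c x => by simp }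
    rw [sum_fin_succ_pi, sum_fin_succ_pi]
    simp only [Fin.prod_univ_succ, Fin.cons_zero, Fin.cons_succ, multilinear_cons, mul_assoc,
      ← Finset.mul_sum, ih]
    simp only [Finset.mul_sum]
    rw [Finset.sum_comm, Finset.sum_comm (s := (Finset.univ : Finset Z'))]
    refine Finset.sum_congr rfl fun z _ => ?_
    simp only [mul_left_comm _ (∏ i, W' (z i)), ← Finset.mul_sum, lin]

/-- The first two moments of a sum of `n` independent copies of a real random variable with
finitely many values. -/
theorem iid_sum_moments {Z : Type*} [Fintype Z] {w : Z → ℝ} (hw : ∑ z, w z = 1) (φ : Z → ℝ)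
    (n : ℕ) :
    ∑ z : Fin n → Z, ∏ i, w (z i) = 1 ∧
    ∑ z : Fin n → Z, (∏ i, w (z i)) * ∑ i, φ (z i) = n * ∑ z, w z * φ z ∧
    ∑ z : Fin n → Z, (∏ i, w (z i)) * (∑ i, φ (z i)) ^ 2
      = n * ∑ z, w z * φ z ^ 2 + n * (n - 1) * (∑ z, w z * φ z) ^ 2 := by
  induction n with
  | zero => simp
  | succ n ih =>
    obtain ⟨h0, h1, h2⟩ := ih
    refine ⟨?_, ?_, ?_⟩
    · rw [sum_fin_succ_pi]
      simp [Fin.prod_univ_succ, ← Finset.mul_sum, h0, hw]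
    · rw [sum_fin_succ_pi]
      have e (x : Z) (z : Fin n → Z) :
          (∏ i, w ((Fin.cons x z : Fin (n + 1) → Z) i))
            * ∑ i, φ ((Fin.cons x z : Fin (n + 1) → Z) i)
          = w x * φ x * (∏ i, w (z i)) + w x * ((∏ i, w (z i)) * ∑ i, φ (z i)) := by
        simp only [Fin.prod_univ_succ, Fin.sum_univ_succ, Fin.cons_zero, Fin.cons_succ]
        ring
      simp only [e, Finset.sum_add_distrib, ← Finset.mul_sum, h0, h1, ← Finset.sum_mul, hw]
      push_cast
      ring
    · rw [sum_fin_succ_pi]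
      have e (x : Z) (z : Fin n → Z) :
          (∏ i, w ((Fin.cons x z : Fin (n + 1) → Z) i))
            * (∑ i, φ ((Fin.cons x z : Fin (n + 1) → Z) i)) ^ 2
          = w x * φ x ^ 2 * (∏ i, w (z i)) + 2 * (w x * φ x) * ((∏ i, w (z i)) * ∑ i, φ (z i))
            + w x * ((∏ i, w (z i)) * (∑ i, φ (z i)) ^ 2) := by
        simp only [Fin.prod_univ_succ, Fin.sum_univ_succ, Fin.cons_zero, Fin.cons_succ]
        ring
      simp only [e, Finset.sum_add_distrib, ← Finset.mul_sum, h0, h1, h2, ← Finset.sum_mul, hw]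
      push_cast
      ring

/-- The second moments of the mean of `K` independent copies of `v` are those of the mixture that
takes a fresh copy of `v` with weight `1 / K` and the expectation of `v` with weight `1 - 1 / K`. -/
theorem sum_iid_mean_sq {Z E : Type*} [Fintype Z] [AddCommGroup E] [Module ℝ E] {w : Z → ℝ}
    (hw : ∑ z, w z = 1) (v : Z → E) {K : ℕ} (hK : 0 < K) (ℓ : E →ₗ[ℝ] ℝ) :
    ∑ z : Fin K → Z, (∏ i, w (z i)) * ℓ ((K : ℝ)⁻¹ • ∑ i, v (z i)) ^ 2
      = ∑ z : Z × Bool, (w z.1 * if z.2 then (K : ℝ)⁻¹ else 1 - (K : ℝ)⁻¹)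
          * ℓ (if z.2 then v z.1 else ∑ y, w y • v y) ^ 2 := by
  have h2 := (iid_sum_moments hw (fun z => ℓ (v z)) K).2.2
  have hK' : (K : ℝ) ≠ 0 := by positivity
  have e (z : Fin K → Z) : (∏ i, w (z i)) * ℓ ((K : ℝ)⁻¹ • ∑ i, v (z i)) ^ 2
      = (K : ℝ)⁻¹ ^ 2 * ((∏ i, w (z i)) * (∑ i, ℓ (v (z i))) ^ 2) := by
    simp only [map_smul, map_sum, smul_eq_mul]
    ring
  rw [Finset.sum_congr rfl fun z _ => e z, ← Finset.mul_sum, h2]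
  have e' (z : Z) : w z * (K : ℝ)⁻¹ * ℓ (v z) ^ 2 = (K : ℝ)⁻¹ * (w z * ℓ (v z) ^ 2) := by ring
  simp only [Fintype.sum_prod_type, Fintype.sum_bool, if_true, Bool.false_eq_true, if_false,
    Finset.sum_add_distrib, map_sum, map_smul, smul_eq_mul, ← Finset.sum_mul, hw, e',
    ← Finset.mul_sum]
  field_simp

theorem sum_iid_mean {Z E : Type*} [Fintype Z] [AddCommGroup E] [Module ℝ E] {w : Z → ℝ}
    (hw : ∑ z, w z = 1) (v : Z → E) {K : ℕ} (hK : 0 < K) (ℓ : E →ₗ[ℝ] ℝ) :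
    ∑ z : Fin K → Z, (∏ i, w (z i)) * ℓ ((K : ℝ)⁻¹ • ∑ i, v (z i)) = ℓ (∑ y, w y • v y) := by
  have h1 := (iid_sum_moments hw (fun z => ℓ (v z)) K).2.1
  have hK' : (K : ℝ) ≠ 0 := by positivity
  simp only [map_smul, map_sum, smul_eq_mul, mul_left_comm _ (K : ℝ)⁻¹, ← Finset.mul_sum, h1]
  field_simp

/-- The second moment of a multilinear form in the means of independent batches of `K` copies of
`v`, as a sum over the set `T` of the slots that are filled by copies of `v`, while the other slots
are filled by the expectation of `v`. -/
theorem sum_sq_multilinear_batch {Z E : Type*} [Fintype Z] [AddCommGroup E] [Module ℝ E]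
    {w : Z → ℝ} (hw : ∑ z, w z = 1) (v : Z → E) {K : ℕ} (hK : 0 < K) {n : ℕ}
    (B : MultilinearMap ℝ (fun _ : Fin n => E) ℝ) :
    ∑ z : Fin n → Fin K → Z, (∏ i, ∏ k, w (z i k)) * B (fun i => (K : ℝ)⁻¹ • ∑ k, v (z i k)) ^ 2
      = ∑ T : Fin n → Bool, (∏ i, if T i then (K : ℝ)⁻¹ else 1 - (K : ℝ)⁻¹)
          * ∑ d : Fin n → Z, (∏ i, w (d i))
            * B (fun i => if T i then v (d i) else ∑ y, w y • v y) ^ 2 := by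
  rw [sum_pow_multilinear_congr (k := 2) (W := fun z : Fin K → Z => ∏ k, w (z k))
    (V := fun z => (K : ℝ)⁻¹ • ∑ k, v (z k)) (sum_iid_mean_sq hw v hK) B,
    ← (Equiv.arrowProdEquivProdArrow (Fin n) (fun _ => Z) (fun _ => Bool)).symm.sum_comp,
    Fintype.sum_prod_type_right]
  refine Finset.sum_congr rfl fun T _ => ?_
  rw [Finset.mul_sum]
  refine Finset.sum_congr rfl fun d _ => ?_
  simp only [Equiv.arrowProdEquivProdArrow_symm_apply, Finset.prod_mul_distrib]
  ring

theorem sum_multilinear_batch {Z E : Type*} [Fintype Z] [AddCommGroup E] [Module ℝ E]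
    {w : Z → ℝ} (hw : ∑ z, w z = 1) (v : Z → E) {K : ℕ} (hK : 0 < K) {n : ℕ}
    (B : MultilinearMap ℝ (fun _ : Fin n => E) ℝ) :
    ∑ z : Fin n → Fin K → Z, (∏ i, ∏ k, w (z i k)) * B (fun i => (K : ℝ)⁻¹ • ∑ k, v (z i k))
      = B fun _ => ∑ y, w y • v y := by
  have := sum_pow_multilinear_congr (k := 1) (W := fun z : Fin K → Z => ∏ k, w (z k))
    (V := fun z => (K : ℝ)⁻¹ • ∑ k, v (z k)) (W' := fun _ : Unit => (1 : ℝ))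
    (V' := fun _ => ∑ y, w y • v y) (fun ℓ => by simpa using sum_iid_mean hw v hK ℓ) B
  simpa using this

/-! ### Single-qubit shadows and their tensor products -/

theorem sum_pauliBasis {R : Type*} [AddCommMonoid R] (f : PauliBasis → R) :
    ∑ b, f b = f .X + f .Y + f .Z := by
  change ∑ b ∈ ({.X, .Y, .Z} : Finset PauliBasis), f b = _
  simp [add_assoc]

theorem card_pauliBasis : Fintype.card PauliBasis = 3 := rfl

theorem proj_eq (d : PauliBasis × Bool) : proj d = match d with
    | (.Z, true) => !![1, 0; 0, 0]
    | (.Z, false) => !![0, 0; 0, 1]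
    | (.X, true) => !![1 / 2, 1 / 2; 1 / 2, 1 / 2]
    | (.X, false) => !![1 / 2, -1 / 2; -1 / 2, 1 / 2]
    | (.Y, true) => !![1 / 2, -Complex.I / 2; Complex.I / 2, 1 / 2]
    | (.Y, false) => !![1 / 2, Complex.I / 2; -Complex.I / 2, 1 / 2] := by
  have h2 : ((√2 : ℝ) : ℂ) ^ 2 = 2 := by
    rw [← Complex.ofReal_pow]
    simp
  have h3 : ((√2 : ℝ) : ℂ) ≠ 0 := by simp
  rcases d with ⟨_ | _ | _, _ | _⟩ <;> ext i j <;> fin_cases i <;> fin_cases j <;>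
    simp [proj, ket] <;> field_simp <;> simp [h2]

theorem sum_sign_proj (b : PauliBasis) (i j : Fin 2) :
    ∑ s, proj (b, s) i j = (1 : Matrix (Fin 2) (Fin 2) ℂ) i j := by
  cases b <;> fin_cases i <;> fin_cases j <;> simp [proj_eq, neg_div] <;> norm_num

/-- Classical shadows are unbiased: averaging the shadow over the outcomes of the measurement of
a matrix with the Born rule gives the matrix back. -/
theorem sum_proj_mul_shadow (x y k l : Fin 2) :
    ∑ e, (1 / 3 : ℂ) * (proj e y x * ((3 : ℂ) • proj e - 1) k l)
      = if x = k ∧ y = l then 1 else 0 := by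
  rw [Fintype.sum_prod_type, sum_pauliBasis]
  have hI := Complex.I_mul_I
  fin_cases x <;> fin_cases y <;> fin_cases k <;> fin_cases l <;>
    simp [proj_eq] <;> ring_nf <;> simp [Complex.I_sq] <;> norm_num

/-- The shadow of a register of qubits as a vector, indexed by pairs of basis labels. -/
noncomputable def shadowVec {n : ℕ} (d : Fin n → PauliBasis × Bool) (k : Bits n × Bits n) : ℂ :=
  tensor (fun i => (3 : ℂ) • proj (d i) - 1) k.1 k.2

theorem sum_bits_pair {n : ℕ} (F : Fin n → Fin 2 → Fin 2 → ℂ) :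
    ∑ k : Bits n × Bits n, ∏ i, F i (k.1 i) (k.2 i) = ∏ i, ∑ x, ∑ y, F i x y := by
  rw [← (Equiv.arrowProdEquivProdArrow (Fin n) (fun _ => Fin 2) (fun _ => Fin 2)).sum_comp]
  simp only [Equiv.arrowProdEquivProdArrow_apply, ← Fintype.sum_prod_type', Fintype.prod_sum]

/-- Bound on the square of the overlap of two single-qubit shadows with given bases. -/
noncomputable def overlapBound (a b : PauliBasis) : ℝ := if a = b then 25 else 1 / 4

theorem normSq_shadow_overlap_le (d e : PauliBasis × Bool) :
    ‖∑ x, ∑ y, ((3 : ℂ) • proj d - 1) x y * star (((3 : ℂ) • proj e - 1) x y)‖ ^ 2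
      ≤ overlapBound d.1 e.1 := by
  rw [Complex.sq_norm]
  rcases d with ⟨_ | _ | _, _ | _⟩ <;> rcases e with ⟨_ | _ | _, _ | _⟩ <;>
    simp [proj_eq, overlapBound, Complex.normSq_apply, neg_div, Complex.conj_ofNat] <;> norm_num

theorem normSq_shadowVec_overlap_le {n : ℕ} (d e : Fin n → PauliBasis × Bool) :
    ‖∑ k, shadowVec d k * star (shadowVec e k)‖ ^ 2
      ≤ ∏ i, overlapBound (d i).1 (e i).1 := by
  simp only [shadowVec, tensor, Matrix.of_apply, star_prod, ← Finset.prod_mul_distrib]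
  rw [sum_bits_pair fun i x y => ((3 : ℂ) • proj (d i) - 1) x y
    * star (((3 : ℂ) • proj (e i) - 1) x y), norm_prod, ← Finset.prod_pow]
  exact Finset.prod_le_prod (fun _ _ => by positivity) fun i _ => normSq_shadow_overlap_le _ _

theorem overlapBound_nonneg (a b : PauliBasis) : 0 ≤ overlapBound a b := by
  unfold overlapBound
  split_ifs <;> norm_num

theorem expect_pi_eq (n : ℕ) (f : (Fin n → PauliBasis) → ℝ) :
    Finset.expect Finset.univ f = (1 / 3) ^ n * ∑ a, f a := by
  rw [Fintype.expect_eq_sum_div_card]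
  simp [card_pauliBasis, div_eq_inv_mul]

/-- For independent uniformly random bases the overlap bound averages to `17 / 2 ≤ 9` per qubit. -/
theorem expect_prod_overlapBound_le (n : ℕ) :
    Finset.expect Finset.univ (fun a : Fin n → PauliBasis =>
      Finset.expect Finset.univ fun b : Fin n → PauliBasis => ∏ i, overlapBound (a i) (b i))
      ≤ 3 ^ (n + n) := by
  have h (a : PauliBasis) : ∑ b, overlapBound a b = 51 / 2 := by
    rw [sum_pauliBasis]
    cases a <;> simp [overlapBound] <;> norm_num
  have e (a : Fin n → PauliBasis) :
      ∑ b : Fin n → PauliBasis, ∏ i, overlapBound (a i) (b i) = (51 / 2) ^ n := by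
    rw [← Fintype.prod_sum fun i b => overlapBound (a i) b]
    simp only [h, Finset.prod_const, Finset.card_univ, Fintype.card_fin]
  simp only [expect_pi_eq, e]
  simp only [Finset.sum_const, Finset.card_univ, Fintype.card_pi, card_pauliBasis,
    Finset.prod_const, Fintype.card_fin, nsmul_eq_mul, Nat.cast_pow, Nat.cast_ofNat, ← mul_pow]
  rw [← two_mul, pow_mul]
  gcongr
  norm_num

theorem sum_normSq_single_le (z : Fin 2 × Fin 2 → ℂ) :
    ∑ e, ‖∑ k : Fin 2 × Fin 2, ((3 : ℂ) • proj e - 1) k.1 k.2 * z k‖ ^ 2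
      ≤ 9 * ∑ k, ‖z k‖ ^ 2 := by
  simp only [Complex.sq_norm]
  rw [Fintype.sum_prod_type, sum_pauliBasis]
  simp [Fintype.sum_prod_type, proj_eq, Complex.normSq_apply]
  nlinarith [sq_nonneg ((z (0, 0)).re + (z (1, 1)).re), sq_nonneg ((z (0, 0)).im + (z (1, 1)).im)]

/-- A Bessel-type bound for a family of vectors is inherited by its tensor powers. -/
theorem sum_normSq_pi_le {A κ : Type*} [Fintype A] [Fintype κ] {t : A → κ → ℂ} {C : ℝ}
    (hC : 0 ≤ C) (h : ∀ z : κ → ℂ, ∑ e, ‖∑ k, t e k * z k‖ ^ 2 ≤ C * ∑ k, ‖z k‖ ^ 2) (n : ℕ)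
    (z : (Fin n → κ) → ℂ) :
    ∑ d : Fin n → A, ‖∑ k, (∏ i, t (d i) (k i)) * z k‖ ^ 2 ≤ C ^ n * ∑ k, ‖z k‖ ^ 2 := by
  induction n with
  | zero => simp
  | succ n ih =>
    have e (d₀ : A) (d : Fin n → A) :
        ∑ k : Fin (n + 1) → κ, (∏ i, t ((Fin.cons d₀ d : Fin (n + 1) → A) i) (k i)) * z k
          = ∑ k : Fin n → κ, (∏ i, t (d i) (k i)) * ∑ k₀, t d₀ k₀ * z (Fin.cons k₀ k) := by
      rw [sum_fin_succ_pi, Finset.sum_comm]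
      refine Finset.sum_congr rfl fun k _ => ?_
      rw [Finset.mul_sum]
      refine Finset.sum_congr rfl fun k₀ _ => ?_
      simp only [Fin.prod_univ_succ, Fin.cons_zero, Fin.cons_succ]
      ring
    rw [sum_fin_succ_pi, sum_fin_succ_pi]
    simp only [e]
    calc _ ≤ ∑ d₀, C ^ n * ∑ k : Fin n → κ, ‖∑ k₀, t d₀ k₀ * z (Fin.cons k₀ k)‖ ^ 2 :=
          Finset.sum_le_sum fun d₀ _ => ih _
      _ = C ^ n * ∑ k : Fin n → κ, ∑ d₀, ‖∑ k₀, t d₀ k₀ * z (Fin.cons k₀ k)‖ ^ 2 := by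
          rw [← Finset.mul_sum, Finset.sum_comm]
      _ ≤ C ^ n * ∑ k : Fin n → κ, C * ∑ k₀, ‖z (Fin.cons k₀ k)‖ ^ 2 := by
          gcongr
          exact h _
      _ = _ := by
          rw [← Finset.mul_sum, Finset.sum_comm, pow_succ, mul_assoc]

theorem sum_normSq_shadowVec_le {n : ℕ} (z : Bits n × Bits n → ℂ) :
    ∑ d, ‖∑ k, shadowVec d k * z k‖ ^ 2 ≤ 9 ^ n * ∑ k, ‖z k‖ ^ 2 := by
  have := sum_normSq_pi_le (by norm_num) sum_normSq_single_le n
    fun k => z (Equiv.arrowProdEquivProdArrow (Fin n) (fun _ => Fin 2) (fun _ => Fin 2) k)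
  rw [← (Equiv.arrowProdEquivProdArrow (Fin n) (fun _ => Fin 2) (fun _ => Fin 2)).sum_comp
    fun k => ‖z k‖ ^ 2]
  simp only [← (Equiv.arrowProdEquivProdArrow (Fin n) (fun _ => Fin 2) (fun _ => Fin 2)).sum_comp
    fun k => shadowVec _ k * z k]
  exact this

/-! ### The law of the measurement records -/

theorem recordProb_nonneg {NA NB : ℕ} {ρ : Matrix (BitsAB NA NB) (BitsAB NA NB) ℂ}
    (hρ : ρ.PosSemidef) (d : Record NA NB) : 0 ≤ recordProb ρ d := by
  -- the projector of a record is `|K⟩⟨K|` for a product vector `K`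
  set K : BitsAB NA NB → ℂ := fun x => (∏ i, ket (d.1 i) (x.1 i)) * ∏ j, ket (d.2 j) (x.2 j)
  have h : (ρ * recordProj d).trace = star K ⬝ᵥ ρ.mulVec K := by
    simp only [Matrix.trace, Matrix.diag_apply, Matrix.mul_apply, dotProduct, Matrix.mulVec,
      Finset.mul_sum]
    refine Finset.sum_congr rfl fun x _ => Finset.sum_congr rfl fun y _ => ?_
    simp only [recordProj, Matrix.kroneckerMap_apply, tensor, Matrix.of_apply, proj, K,
      Finset.prod_mul_distrib, Pi.star_apply, star_mul', star_prod]
    ring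
  have := hρ.re_dotProduct_nonneg K
  rw [← h] at this
  exact mul_nonneg (by positivity) this

theorem sum_sign_tensor_proj {n : ℕ} (a : Fin n → PauliBasis) (x y : Bits n) :
    ∑ s : Fin n → Bool, tensor (fun i => proj (a i, s i)) x y
      = (1 : Matrix (Bits n) (Bits n) ℂ) x y := by
  simp only [tensor, Matrix.of_apply]
  rw [← Fintype.prod_sum fun i s => proj (a i, s) (x i) (y i)]
  simp only [sum_sign_proj, Matrix.one_apply, Finset.prod_boole, funext_iff, Finset.mem_univ,
    forall_const]

theorem sum_sign_recordProj {NA NB : ℕ} (a : Fin NA → PauliBasis) (b : Fin NB → PauliBasis) :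
    ∑ s : Fin NA → Bool, ∑ t : Fin NB → Bool,
      recordProj (fun i => (a i, s i), fun j => (b j, t j)) = 1 := by
  ext x y
  simp only [Matrix.sum_apply, recordProj, Matrix.kroneckerMap_apply, ← Finset.mul_sum,
    ← Finset.sum_mul, sum_sign_tensor_proj]
  rw [← Matrix.kroneckerMap_apply (fun a b : ℂ => a * b), Matrix.one_kronecker_one]

open scoped BigOperators in
/-- The bases in a record are uniformly distributed. -/
theorem sum_recordProb_mul_basis {NA NB : ℕ} {ρ : Matrix (BitsAB NA NB) (BitsAB NA NB) ℂ}
    (hρ : ρ.trace = 1) (h : (Fin NA → PauliBasis) → (Fin NB → PauliBasis) → ℝ) :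
    ∑ d, recordProb ρ d * h (fun i => (d.1 i).1) (fun j => (d.2 j).1) = 𝔼 a, 𝔼 b, h a b := by
  have e (a : Fin NA → PauliBasis) (b : Fin NB → PauliBasis) :
      ∑ s : Fin NA → Bool, ∑ t : Fin NB → Bool,
        recordProb ρ (fun i => (a i, s i), fun j => (b j, t j)) = (1 / 3) ^ (NA + NB) := by
    simp only [recordProb, ← Finset.mul_sum, ← Complex.re_sum, ← Matrix.trace_sum,
      sum_sign_recordProj, mul_one, hρ, Complex.one_re]
  rw [Fintype.sum_prod_type,
    ← (Equiv.arrowProdEquivProdArrow (Fin NA) (fun _ => PauliBasis) (fun _ => Bool)).symm.sum_comp,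
    Fintype.sum_prod_type]
  simp only [← (Equiv.arrowProdEquivProdArrow (Fin NB) (fun _ => PauliBasis)
    (fun _ => Bool)).symm.sum_comp, Fintype.sum_prod_type, expect_pi_eq, Finset.mul_sum]
  refine Finset.sum_congr rfl fun a _ => ?_
  rw [Finset.sum_comm]
  refine Finset.sum_congr rfl fun b _ => ?_
  rw [← mul_assoc, ← pow_add, ← e a b]
  simp only [Finset.sum_mul]
  rfl

theorem sum_recordProb {NA NB : ℕ} {ρ : Matrix (BitsAB NA NB) (BitsAB NA NB) ℂ}
    (hρ : ρ.trace = 1) : ∑ d, recordProb ρ d = 1 := by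
  have : Nonempty PauliBasis := ⟨.X⟩
  simpa using sum_recordProb_mul_basis hρ fun _ _ => 1

theorem sum_tensor_proj_mul_shadow {n : ℕ} (x y k l : Bits n) :
    ∑ d : Fin n → PauliBasis × Bool, (1 / 3 : ℂ) ^ n * (tensor (fun i => proj (d i)) y x
        * tensor (fun i => (3 : ℂ) • proj (d i) - 1) k l)
      = if x = k ∧ y = l then 1 else 0 := by
  have e (d : Fin n → PauliBasis × Bool) :
      (1 / 3 : ℂ) ^ n * (tensor (fun i => proj (d i)) y x
        * tensor (fun i => (3 : ℂ) • proj (d i) - 1) k l)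
      = ∏ i, (1 / 3 : ℂ) * (proj (d i) (y i) (x i)
        * ((3 : ℂ) • proj (d i) - 1) (k i) (l i)) := by
    simp [tensor, Finset.prod_mul_distrib]
  simp only [e]
  rw [← Fintype.prod_sum fun i e => (1 / 3 : ℂ) * (proj e (y i) (x i)
        * ((3 : ℂ) • proj e - 1) (k i) (l i))]
  simp only [sum_proj_mul_shadow, Finset.prod_boole, funext_iff, Finset.mem_univ,
    forall_const, forall_and]

theorem sum_prod_mul {A B : Type*} [Fintype A] [Fintype B] (f : A → ℂ) (g : B → ℂ) :
    ∑ d : A × B, f d.1 * g d.2 = (∑ a, f a) * ∑ b, g b := by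
  rw [Fintype.sum_prod_type, Finset.sum_mul_sum]

theorem trace_mul_recordProj_re {NA NB : ℕ} {ρ : Matrix (BitsAB NA NB) (BitsAB NA NB) ℂ}
    (hρ : ρ.IsHermitian) (d : Record NA NB) :
    (((ρ * recordProj d).trace.re : ℝ) : ℂ) = (ρ * recordProj d).trace := by
  have hp (e : PauliBasis × Bool) : (proj e).IsHermitian := by
    ext x y
    simp [proj, mul_comm]
  refine trace_mul_re hρ ?_
  rw [recordProj, Matrix.IsHermitian, Matrix.conjTranspose_kronecker,
    (tensor_isHermitian fun i => hp (d.1 i)).eq, (tensor_isHermitian fun j => hp (d.2 j)).eq]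

/-- The shadow of a record is an unbiased estimator of the state. -/
theorem sum_recordProb_smul_shadow {NA NB : ℕ} {ρ : Matrix (BitsAB NA NB) (BitsAB NA NB) ℂ}
    (hρ : ρ.IsHermitian) : ∑ d, recordProb ρ d • shadow d = ρ := by
  ext k l
  have e (d : Record NA NB) : (recordProb ρ d • shadow d) k l = ∑ x, ∑ y, ρ x y *
      (((1 / 3 : ℂ) ^ NA * (tensor (fun i => proj (d.1 i)) y.1 x.1
          * tensor (fun i => (3 : ℂ) • proj (d.1 i) - 1) k.1 l.1))
        * ((1 / 3 : ℂ) ^ NB * (tensor (fun i => proj (d.2 i)) y.2 x.2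
          * tensor (fun i => (3 : ℂ) • proj (d.2 i) - 1) k.2 l.2))) := by
    rw [Matrix.smul_apply, Complex.real_smul, recordProb, Complex.ofReal_mul,
      trace_mul_recordProj_re hρ]
    simp only [Matrix.trace, Matrix.diag_apply, Matrix.mul_apply, recordProj, shadow,
      Matrix.kroneckerMap_apply, Finset.mul_sum, Finset.sum_mul]
    push_cast
    refine Finset.sum_congr rfl fun x _ => Finset.sum_congr rfl fun y _ => ?_
    ring
  have hker (x y : BitsAB NA NB) : ∑ d : Record NA NB,
      (((1 / 3 : ℂ) ^ NA * (tensor (fun i => proj (d.1 i)) y.1 x.1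
          * tensor (fun i => (3 : ℂ) • proj (d.1 i) - 1) k.1 l.1))
        * ((1 / 3 : ℂ) ^ NB * (tensor (fun i => proj (d.2 i)) y.2 x.2
          * tensor (fun i => (3 : ℂ) • proj (d.2 i) - 1) k.2 l.2)))
      = if x = k ∧ y = l then 1 else 0 := by
    rw [sum_prod_mul (fun d : Fin NA → PauliBasis × Bool => (1 / 3 : ℂ) ^ NA *
        (tensor (fun i => proj (d i)) y.1 x.1
          * tensor (fun i => (3 : ℂ) • proj (d i) - 1) k.1 l.1))
      (fun d : Fin NB → PauliBasis × Bool => (1 / 3 : ℂ) ^ NB *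
        (tensor (fun i => proj (d i)) y.2 x.2
          * tensor (fun i => (3 : ℂ) • proj (d i) - 1) k.2 l.2)),
      sum_tensor_proj_mul_shadow, sum_tensor_proj_mul_shadow]
    simp only [Prod.ext_iff, mul_ite, mul_one, mul_zero]
    split_ifs <;> first | rfl | (exfalso; tauto)
  rw [Matrix.sum_apply, Finset.sum_congr rfl fun d _ => e d, Finset.sum_comm,
    Finset.sum_congr rfl fun x _ => Finset.sum_comm]
  simp only [← Finset.mul_sum, hker]
  simp [ite_and]

/-! ### Segments between measured copies -/

open scoped Matrix.Norms.Frobenius in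
theorem frobenius_norm_sq {m n : Type*} [Fintype m] [Fintype n] (O : Matrix m n ℂ) :
    ‖O‖ ^ 2 = ∑ i, ∑ j, ‖O i j‖ ^ 2 := by
  have h : 0 ≤ ∑ i, ∑ j, ‖O i j‖ ^ 2 := by positivity
  rw [Matrix.frobenius_norm_def]
  simp only [Real.rpow_two]
  rw [← Real.sqrt_eq_rpow, Real.sq_sqrt h]

open scoped BigOperators in
/-- A function of the outcomes on two registers of `n` and `m` qubits has *bounded basis average* if
it has a majorant that depends on the measurement bases only, and whose average over independent
uniformly random bases is at most `3 ^ (n + m)`. -/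
def BasisAverageBounded {n m : ℕ}
    (g : (Fin n → PauliBasis × Bool) → (Fin m → PauliBasis × Bool) → ℝ) : Prop :=
  ∃ H : (Fin n → PauliBasis) → (Fin m → PauliBasis) → ℝ,
    (∀ a b, 0 ≤ H a b) ∧ (∀ d e, g d e ≤ H (fun i => (d i).1) (fun j => (e j).1)) ∧
    𝔼 a, 𝔼 b, H a b ≤ 3 ^ (n + m)

theorem basisAverageBounded_overlap (n : ℕ) :
    BasisAverageBounded fun d e : Fin n → PauliBasis × Bool =>
      ‖shadowVec d ⬝ᵥ star (shadowVec e)‖ ^ 2 :=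
  ⟨fun a b => ∏ i, overlapBound (a i) (b i),
    fun _ _ => Finset.prod_nonneg fun _ _ => overlapBound_nonneg _ _,
    normSq_shadowVec_overlap_le, expect_prod_overlapBound_le n⟩

/-- Vectors, indexed by the outcomes on `n` qubits, with the Bessel bound of the shadow vectors. -/
def IsShadowFrame {n : ℕ} (x : (Fin n → PauliBasis × Bool) → Bits n × Bits n → ℂ) : Prop :=
  ∀ z : Bits n × Bits n → ℂ, ∑ d, ‖x d ⬝ᵥ z‖ ^ 2 ≤ 9 ^ n * ∑ k, ‖z k‖ ^ 2

theorem isShadowFrame_shadowVec (n : ℕ) : IsShadowFrame (shadowVec (n := n)) :=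
  sum_normSq_shadowVec_le

theorem isShadowFrame_star (n : ℕ) : IsShadowFrame fun d => star (shadowVec (n := n) d) := by
  intro z
  have h := sum_normSq_shadowVec_le (star z)
  simp only [Pi.star_apply, norm_star] at h
  refine le_trans (le_of_eq ?_) h
  refine Finset.sum_congr rfl fun d _ => ?_
  rw [← norm_star]
  simp [dotProduct, star_sum, star_mul', mul_comm]

open scoped Matrix.Norms.Frobenius in
/-- The majorant is the sum over all signs, which amounts to bounding the Born probabilities by one;
the two Bessel bounds control this sum. -/
theorem basisAverageBounded_bilinear {n m : ℕ}
    {x : (Fin n → PauliBasis × Bool) → Bits n × Bits n → ℂ}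
    {y : (Fin m → PauliBasis × Bool) → Bits m × Bits m → ℂ} (hx : IsShadowFrame x)
    (hy : IsShadowFrame y) {O : Matrix (Bits n × Bits n) (Bits m × Bits m) ℂ} (hO : ‖O‖ ≤ 1) :
    BasisAverageBounded fun d e => ‖x d ⬝ᵥ O.mulVec (y e)‖ ^ 2 := by
  refine ⟨fun a b => ∑ s : Fin n → Bool, ∑ t : Fin m → Bool,
    ‖x (fun i => (a i, s i)) ⬝ᵥ O.mulVec (y fun j => (b j, t j))‖ ^ 2,
    fun a b => by positivity, fun d e => ?_, ?_⟩
  · have h1 := Finset.single_le_sum (f := fun t : Fin m → Bool =>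
        ‖x d ⬝ᵥ O.mulVec (y fun j => ((e j).1, t j))‖ ^ 2) (fun _ _ => by positivity)
      (Finset.mem_univ fun j => (e j).2)
    have h2 := Finset.single_le_sum (f := fun s : Fin n → Bool => ∑ t : Fin m → Bool,
        ‖x (fun i => ((d i).1, s i)) ⬝ᵥ O.mulVec (y fun j => ((e j).1, t j))‖ ^ 2)
      (fun _ _ => by positivity) (Finset.mem_univ fun i => (d i).2)
    exact h1.trans h2
  · have hO2 : ∑ k, ∑ l, ‖O k l‖ ^ 2 ≤ 1 := by
      rw [← frobenius_norm_sq]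
      exact pow_le_one₀ (norm_nonneg _) hO
    have hsum : ∑ d, ∑ e, ‖x d ⬝ᵥ O.mulVec (y e)‖ ^ 2 ≤ 9 ^ n * 9 ^ m := by
      calc ∑ d, ∑ e, ‖x d ⬝ᵥ O.mulVec (y e)‖ ^ 2
          = ∑ e, ∑ d, ‖x d ⬝ᵥ O.mulVec (y e)‖ ^ 2 := Finset.sum_comm
        _ ≤ ∑ e, 9 ^ n * ∑ k, ‖O.mulVec (y e) k‖ ^ 2 := Finset.sum_le_sum fun e _ => hx _
        _ = 9 ^ n * ∑ k, ∑ e, ‖y e ⬝ᵥ O k‖ ^ 2 := by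
            rw [← Finset.mul_sum, Finset.sum_comm]
            simp only [Matrix.mulVec, dotProduct_comm]
        _ ≤ 9 ^ n * ∑ k, 9 ^ m * ∑ l, ‖O k l‖ ^ 2 := by
            gcongr with k
            exact hy _
        _ = 9 ^ n * 9 ^ m * ∑ k, ∑ l, ‖O k l‖ ^ 2 := by rw [← Finset.mul_sum, mul_assoc]
        _ ≤ 9 ^ n * 9 ^ m * 1 := by gcongr
        _ = 9 ^ n * 9 ^ m := mul_one _
    have e : ∑ a : Fin n → PauliBasis, ∑ b : Fin m → PauliBasis,
        ∑ s : Fin n → Bool, ∑ t : Fin m → Bool,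
          ‖x (fun i => (a i, s i)) ⬝ᵥ O.mulVec (y fun j => (b j, t j))‖ ^ 2
        = ∑ d, ∑ e, ‖x d ⬝ᵥ O.mulVec (y e)‖ ^ 2 := by
      rw [← (Equiv.arrowProdEquivProdArrow (Fin n) (fun _ => PauliBasis)
          (fun _ => Bool)).symm.sum_comp, Fintype.sum_prod_type]
      simp only [← (Equiv.arrowProdEquivProdArrow (Fin m) (fun _ => PauliBasis)
          (fun _ => Bool)).symm.sum_comp, Fintype.sum_prod_type]
      refine Finset.sum_congr rfl fun a _ => ?_
      rw [Finset.sum_comm]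
      rfl
    simp only [expect_pi_eq, ← Finset.mul_sum, e]
    calc _ ≤ (1 / 3 : ℝ) ^ n * ((1 / 3) ^ m * (9 ^ n * 9 ^ m)) := by gcongr
      _ = (1 / 3 * 9) ^ n * (1 / 3 * 9) ^ m := by
          rw [mul_pow, mul_pow]
          ring
      _ = 3 ^ (n + m) := by norm_num [pow_add]

open scoped BigOperators in
/-- For functions of the bases only, averaging over four independent records amounts to averaging
over independent uniform bases on the eight registers. -/
theorem sum_recordProb_four {NA NB : ℕ} {ρ : Matrix (BitsAB NA NB) (BitsAB NA NB) ℂ}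
    (hρ : ρ.trace = 1)
    (F : (Fin NA → PauliBasis) → (Fin NB → PauliBasis) → (Fin NA → PauliBasis) →
      (Fin NB → PauliBasis) → (Fin NA → PauliBasis) → (Fin NB → PauliBasis) →
      (Fin NA → PauliBasis) → (Fin NB → PauliBasis) → ℝ) :
    ∑ d : Fin 4 → Record NA NB, (∏ i, recordProb ρ (d i)) *
      F (fun i => ((d 0).1 i).1) (fun j => ((d 0).2 j).1) (fun i => ((d 1).1 i).1)
        (fun j => ((d 1).2 j).1) (fun i => ((d 2).1 i).1) (fun j => ((d 2).2 j).1)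
        (fun i => ((d 3).1 i).1) (fun j => ((d 3).2 j).1)
      = 𝔼 a₀, 𝔼 b₀, 𝔼 a₁, 𝔼 b₁, 𝔼 a₂, 𝔼 b₂, 𝔼 a₃, 𝔼 b₃, F a₀ b₀ a₁ b₁ a₂ b₂ a₃ b₃ := by
  have hm := sum_recordProb_mul_basis hρ
  have h3 (a₀ b₀ a₁ b₁ a₂ b₂) := hm fun a b => F a₀ b₀ a₁ b₁ a₂ b₂ a b
  have h2 (a₀ b₀ a₁ b₁) := hm fun a b => 𝔼 a₃, 𝔼 b₃, F a₀ b₀ a₁ b₁ a b a₃ b₃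
  have h1 (a₀ b₀) := hm fun a b => 𝔼 a₂, 𝔼 b₂, 𝔼 a₃, 𝔼 b₃, F a₀ b₀ a b a₂ b₂ a₃ b₃
  have h0 := hm fun a b => 𝔼 a₁, 𝔼 b₁, 𝔼 a₂, 𝔼 b₂, 𝔼 a₃, 𝔼 b₃, F a b a₁ b₁ a₂ b₂ a₃ b₃
  rw [← h0]
  simp only [← h1]
  simp only [← h2]
  simp only [← h3]
  simp only [sum_fin_succ_pi, Fin.prod_univ_four, Finset.univ_unique, Finset.sum_singleton]
  simp only [Finset.mul_sum, ← mul_assoc]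
  rfl

/-! ### The cyclic trace of four copies -/

/-- The cyclic trace `Tr (M₀ M₁ᴴ M₂ M₃ᴴ)`. -/
noncomputable def cyclicTrace {U W : Type*} [Fintype U] [Fintype W]
    (M : Fin 4 → Matrix U W ℂ) : ℂ :=
  (M 0 * (M 1).conjTranspose * M 2 * (M 3).conjTranspose).trace

/-- The realignment of an operator on `AB`, with rows labelled by the two indices on `A` and columns
by the two indices on `B`. -/
def realign {NA NB : ℕ} (X : Matrix (BitsAB NA NB) (BitsAB NA NB) ℂ) :
    Matrix (Bits NA × Bits NA) (Bits NB × Bits NB) ℂ :=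
  Matrix.of fun k l => X (k.1, l.1) (k.2, l.2)

theorem realign_shadow {NA NB : ℕ} (d : Record NA NB) :
    realign (shadow d) = Matrix.vecMulVec (shadowVec d.1) (shadowVec d.2) := by
  ext k l
  rfl

open scoped MatrixOrder Matrix.Norms.L2Operator in
theorem exists_eq_conjTranspose_mul_self {κ : Type*} [Fintype κ] [DecidableEq κ]
    {A : Matrix κ κ ℂ} (hA : A.PosSemidef) : ∃ C : Matrix κ κ ℂ, A = C.conjTranspose * C :=
  CStarAlgebra.nonneg_iff_eq_star_mul_self.mp hA.nonneg

open scoped Matrix.Norms.Frobenius in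
/-- The Frobenius norm of a state, whose square is the purity, is at most one. -/
theorem norm_realign_le {NA NB : ℕ} {ρ : Matrix (BitsAB NA NB) (BitsAB NA NB) ℂ}
    (hρ : IsDensityMatrix ρ) : ‖realign ρ‖ ≤ 1 := by
  have h1 : ‖realign ρ‖ = ‖ρ‖ := by
    rw [← sq_eq_sq₀ (norm_nonneg _) (norm_nonneg _), frobenius_norm_sq, frobenius_norm_sq]
    simp only [Fintype.sum_prod_type, realign, Matrix.of_apply]
    refine Finset.sum_congr rfl fun a _ => ?_
    rw [Finset.sum_comm]
  obtain ⟨C, hC⟩ := exists_eq_conjTranspose_mul_self hρ.posSemidef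
  have h2 : ‖C‖ ^ 2 = 1 := by
    have h := hρ.trace_eq_one
    rw [hC, Matrix.trace] at h
    simp only [Matrix.diag_apply, Matrix.mul_apply, Matrix.conjTranspose_apply] at h
    rw [frobenius_norm_sq, Finset.sum_comm]
    have e (i j) : star (C i j) * C i j = ((‖C i j‖ ^ 2 : ℝ) : ℂ) := by
      rw [mul_comm]
      simpa using Complex.mul_conj' (C i j)
    simp only [e] at h
    exact_mod_cast h
  calc ‖realign ρ‖ = ‖C.conjTranspose * C‖ := by rw [h1, ← hC]
    _ ≤ ‖C.conjTranspose‖ * ‖C‖ := Matrix.frobenius_norm_mul _ _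
    _ = ‖C‖ ^ 2 := by rw [Matrix.frobenius_norm_conjTranspose, sq]
    _ ≤ 1 := h2.le

theorem trace_basisMap_mul {κ : Type*} [Fintype κ] [DecidableEq κ] (f : κ → κ)
    (T : Matrix κ κ ℂ) : (basisMap f * T).trace = ∑ y, T y (f y) := by
  simp only [Matrix.trace, Matrix.diag_apply, Matrix.mul_apply, basisMap, Matrix.of_apply,
    ite_mul, one_mul, zero_mul]
  rw [Finset.sum_comm]
  simp

/-- The swaps connect the `A` parts of the copies `0, 3` and `1, 2` and the `B` parts of the copies
`0, 1` and `2, 3`, so that the four copies form a cycle. -/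
theorem trace_opS_mul_tensor {NA NB : ℕ}
    {X : Fin 4 → Matrix (BitsAB NA NB) (BitsAB NA NB) ℂ} (hX : ∀ i, (X i).IsHermitian) :
    (opS NA NB * tensor X).trace = cyclicTrace fun i => realign (X i) := by
  unfold opS swapA swapB
  rw [basisMap_mul, basisMap_mul, basisMap_mul, trace_basisMap_mul]
  let e : (Fin 4 → BitsAB NA NB) ≃ ((Bits NA × Bits NA) × (Bits NB × Bits NB)) ×
      ((Bits NA × Bits NA) × (Bits NB × Bits NB)) :=
    { toFun := fun y => ((((y 0).1, (y 3).1), ((y 2).2, (y 3).2)),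
        (((y 2).1, (y 1).1), ((y 0).2, (y 1).2)))
      invFun := fun z => ![(z.1.1.1, z.2.2.1), (z.2.1.2, z.2.2.2), (z.2.1.1, z.1.2.1),
        (z.1.1.2, z.1.2.2)]
      left_inv := fun y => by
        funext c
        fin_cases c <;> rfl
      right_inv := fun z => rfl }
  rw [← e.symm.sum_comp, Fintype.sum_prod_type]
  have hcyc : (cyclicTrace fun i => realign (X i)) =
      ∑ kn : (Bits NA × Bits NA) × (Bits NB × Bits NB),
      ∑ ml : (Bits NA × Bits NA) × (Bits NB × Bits NB),
        realign (X 0) kn.1 ml.2 * star (realign (X 1) ml.1 ml.2) * realign (X 2) ml.1 kn.2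
          * star (realign (X 3) kn.1 kn.2) := by
    simp only [cyclicTrace, Matrix.trace, Matrix.diag_apply, Matrix.mul_apply,
      Matrix.conjTranspose_apply, Finset.sum_mul]
    conv_rhs => rw [Fintype.sum_prod_type]
    refine Finset.sum_congr rfl fun k _ => Finset.sum_congr rfl fun n _ => ?_
    conv_rhs => rw [Fintype.sum_prod_type]
  rw [hcyc]
  refine Finset.sum_congr rfl fun kn _ => Finset.sum_congr rfl fun ml _ => ?_
  have h1 := (hX 1).apply (ml.1.2, ml.2.2) (ml.1.1, ml.2.1)
  have h3 := (hX 3).apply (kn.1.2, kn.2.2) (kn.1.1, kn.2.1)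
  simp only [realign, Matrix.of_apply, h1, h3, tensor, Fin.prod_univ_four]
  rfl

/-- The symmetries of the cycle that act simply transitively on the four copies change the
cyclic trace at most by complex conjugation. -/
theorem exists_perm_norm_cyclicTrace {U W : Type*} [Fintype U] [Fintype W] (j : Fin 4) :
    ∃ κ : Equiv.Perm (Fin 4), κ 0 = j ∧
      ∀ M : Fin 4 → Matrix U W ℂ, ‖cyclicTrace fun i => M (κ i)‖ = ‖cyclicTrace M‖ := by
  have hstar (M : Fin 4 → Matrix U W ℂ) :
      star (cyclicTrace M) = (M 3 * (M 2).conjTranspose * M 1 * (M 0).conjTranspose).trace := by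
    rw [cyclicTrace, ← Matrix.trace_conjTranspose]
    simp [Matrix.mul_assoc]
  have hrot (M : Fin 4 → Matrix U W ℂ) :
      cyclicTrace M = (M 2 * (M 3).conjTranspose * M 0 * (M 1).conjTranspose).trace := by
    rw [cyclicTrace, Matrix.mul_assoc, Matrix.trace_mul_comm]
    simp [Matrix.mul_assoc]
  fin_cases j
  · exact ⟨1, rfl, fun M => rfl⟩
  · refine ⟨Equiv.swap 0 1 * Equiv.swap 2 3, by decide, fun M => ?_⟩
    rw [← norm_star (cyclicTrace M), hstar M, hrot]
    rfl
  · refine ⟨Equiv.swap 0 2 * Equiv.swap 1 3, by decide, fun M => ?_⟩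
    rw [hrot M]
    rfl
  · refine ⟨Equiv.swap 0 3 * Equiv.swap 1 2, by decide, fun M => ?_⟩
    rw [← norm_star (cyclicTrace M), hstar M]
    rfl

open scoped BigOperators in
/-- An average over four records is bounded by the average over the bases of any majorant `F` that
depends on the bases only. -/
theorem sum_recordProb_mul_le {NA NB : ℕ} {ρ : Matrix (BitsAB NA NB) (BitsAB NA NB) ℂ}
    (hρ : IsDensityMatrix ρ) {g : (Fin 4 → Record NA NB) → ℝ}
    (F : (Fin NA → PauliBasis) → (Fin NB → PauliBasis) → (Fin NA → PauliBasis) →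
      (Fin NB → PauliBasis) → (Fin NA → PauliBasis) → (Fin NB → PauliBasis) →
      (Fin NA → PauliBasis) → (Fin NB → PauliBasis) → ℝ)
    (hF : ∀ d, g d ≤ F (fun i => ((d 0).1 i).1) (fun j => ((d 0).2 j).1)
      (fun i => ((d 1).1 i).1) (fun j => ((d 1).2 j).1) (fun i => ((d 2).1 i).1)
      (fun j => ((d 2).2 j).1) (fun i => ((d 3).1 i).1) (fun j => ((d 3).2 j).1)) :
    ∑ d : Fin 4 → Record NA NB, (∏ i, recordProb ρ (d i)) * g d
      ≤ 𝔼 a₀, 𝔼 b₀, 𝔼 a₁, 𝔼 b₁, 𝔼 a₂, 𝔼 b₂, 𝔼 a₃, 𝔼 b₃, F a₀ b₀ a₁ b₁ a₂ b₂ a₃ b₃ := by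
  rw [← sum_recordProb_four hρ.trace_eq_one]
  exact Finset.sum_le_sum fun d _ => mul_le_mul_of_nonneg_left (hF d)
    (Finset.prod_nonneg fun i _ => recordProb_nonneg hρ.posSemidef _)

open scoped BigOperators in
theorem BasisAverageBounded.exists_majorant {n m : ℕ}
    {g : (Fin n → PauliBasis × Bool) → (Fin m → PauliBasis × Bool) → ℝ}
    (hg : BasisAverageBounded g) :
    ∃ H : (Fin n → PauliBasis) → (Fin m → PauliBasis) → ℝ,
      (∀ a b, 0 ≤ H a b) ∧ (∀ d e, g d e ≤ H (fun i => (d i).1) (fun j => (e j).1)) ∧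
      0 ≤ 𝔼 a, 𝔼 b, H a b ∧ 𝔼 a, 𝔼 b, H a b ≤ 3 ^ (n + m) ∧
      𝔼 b, 𝔼 a, H a b = 𝔼 a, 𝔼 b, H a b := by
  obtain ⟨H, h0, h1, h2⟩ := hg
  exact ⟨H, h0, h1, Finset.expect_nonneg fun _ _ => Finset.expect_nonneg fun _ _ => h0 _ _, h2,
    Finset.expect_comm _ _ _⟩

theorem vecMulVec_mulVec_eq {U W : Type*} [Fintype W] (u : U → ℂ) (v w : W → ℂ) :
    (Matrix.vecMulVec u v).mulVec w = (v ⬝ᵥ w) • u := by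
  rw [Matrix.vecMulVec_mulVec, op_smul_eq_smul]

open scoped BigOperators Matrix.Norms.Frobenius in
/-- The second moment of the cyclic trace in which the copy `0` is measured. The measured copies are
rank one after realignment, so they cut the cycle into segments, and the trace is the product of the
values of the segments. Different segments involve different registers, whose bases are
independent. -/
theorem sum_normSq_cyclicTrace_le_of_zero {NA NB : ℕ}
    {ρ : Matrix (BitsAB NA NB) (BitsAB NA NB) ℂ} (hρ : IsDensityMatrix ρ) {T : Fin 4 → Bool}
    (hT : T 0 = true) :
    ∑ d : Fin 4 → Record NA NB, (∏ i, recordProb ρ (d i)) *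
        ‖cyclicTrace fun i => realign (if T i then shadow (d i) else ρ)‖ ^ 2
      ≤ ∏ i, if T i then 3 ^ (NA + NB) else 1 := by
  have : Nonempty PauliBasis := ⟨.X⟩
  have hR := norm_realign_le hρ
  have hR1 : ‖(realign ρ).conjTranspose‖ ≤ 1 := by
    rwa [Matrix.frobenius_norm_conjTranspose]
  have hmul {l m n : Type} [Fintype l] [Fintype m] [Fintype n] {P : Matrix l m ℂ}
      {Q : Matrix m n ℂ} (hP : ‖P‖ ≤ 1) (hQ : ‖Q‖ ≤ 1) : ‖P * Q‖ ≤ 1 :=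
    (Matrix.frobenius_norm_mul P Q).trans (mul_le_one₀ hP (norm_nonneg _) hQ)
  -- expand the trace into segments
  have hexp (M : Fin 4 → Matrix (Bits NA × Bits NA) (Bits NB × Bits NB) ℂ) (x y)
      (h : M 0 = Matrix.vecMulVec x y) : cyclicTrace M = y ⬝ᵥ (M 1).conjTranspose.mulVec
        ((M 2).mulVec ((M 3).conjTranspose.mulVec x)) := by
    rw [cyclicTrace, h, Matrix.vecMulVec_mul, Matrix.vecMulVec_mul, Matrix.vecMulVec_mul,
      Matrix.trace_vecMulVec, dotProduct_comm, ← Matrix.dotProduct_mulVec,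
      ← Matrix.dotProduct_mulVec, ← Matrix.dotProduct_mulVec]
  have hcyc (d : Fin 4 → Record NA NB) :=
    hexp (fun i => realign (if T i then shadow (d i) else ρ)) (shadowVec (d 0).1)
      (shadowVec (d 0).2) (by simp only [hT, if_true, realign_shadow])
  have hprod := Fin.prod_univ_four fun i => if T i then (3 : ℝ) ^ (NA + NB) else 1
  simp only [hT, if_true] at hprod
  simp only [hcyc, hprod]
  have fr := isShadowFrame_shadowVec
  have fs := isShadowFrame_star
  obtain ⟨HA, nA, hA, pA, eA, cA⟩ := (basisAverageBounded_overlap NA).exists_majorant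
  obtain ⟨HB, nB, hB, pB, eB, cB⟩ := (basisAverageBounded_overlap NB).exists_majorant
  have hA' (d e) := (hA d e).trans' (le_of_eq (by rw [dotProduct_comm]))
  -- one case for each set of measured copies; `H` is the majorant of the segments that contain `ρ`,
  -- `HA` and `HB` are those of the overlaps of neighbouring measured copies
  cases h1 : T 1 <;> cases h2 : T 2 <;> cases h3 : T 3 <;>
    simp only [if_true, if_false, Bool.false_eq_true, realign_shadow, vecMulVec_mulVec_eq,
      Matrix.conjTranspose_vecMulVec, Matrix.mulVec_smul, dotProduct_smul, smul_eq_mul, norm_mul,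
      mul_pow, mul_one]
  -- measured: copy 0
  · obtain ⟨H, -, h, -, e, c⟩ :=
      (basisAverageBounded_bilinear (fr NB) (fr NA) (hmul hR1 (hmul hR hR1))).exists_majorant
    simp only [Matrix.mulVec_mulVec] at h ⊢
    refine (sum_recordProb_mul_le hρ (fun a₀ b₀ a₁ b₁ a₂ b₂ a₃ b₃ =>
      H b₀ a₀) fun d =>
      (h _ _)).trans ?_
    simp only [Fintype.expect_const, c]
    refine e.trans_eq ?_
    ring
  -- measured: copies 0, 3
  · obtain ⟨H, n, h, p, e, c⟩ :=
      (basisAverageBounded_bilinear (fr NB) (fs NB) (hmul hR1 hR)).exists_majorant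
    simp only [Matrix.mulVec_mulVec] at h ⊢
    refine (sum_recordProb_mul_le hρ (fun a₀ b₀ a₁ b₁ a₂ b₂ a₃ b₃ =>
      HA a₀ a₃ * H b₀ b₃) fun d =>
      mul_le_mul (hA' _ _) (h _ _) (by positivity) (nA _ _)).trans ?_
    simp only [← Finset.mul_expect, ← Finset.expect_mul, Fintype.expect_const]
    refine (mul_le_mul eA e p
      (by positivity)).trans_eq ?_
    ring
  -- measured: copies 0, 2
  · obtain ⟨H, n, h, p, e, c⟩ :=
      (basisAverageBounded_bilinear (fr NB) (fr NA) hR1).exists_majorant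
    refine (sum_recordProb_mul_le hρ (fun a₀ b₀ a₁ b₁ a₂ b₂ a₃ b₃ =>
      H b₂ a₀ * H b₀ a₂) fun d =>
      mul_le_mul (h _ _) (h _ _) (by positivity) (n _ _)).trans ?_
    simp only [← Finset.mul_expect, ← Finset.expect_mul, Fintype.expect_const, c]
    refine (mul_le_mul e e p
      (by positivity)).trans_eq ?_
    ring
  -- measured: copies 0, 2, 3
  · obtain ⟨H, n, h, p, e, c⟩ :=
      (basisAverageBounded_bilinear (fr NB) (fr NA) hR1).exists_majorant
    refine (sum_recordProb_mul_le hρ (fun a₀ b₀ a₁ b₁ a₂ b₂ a₃ b₃ =>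
      HA a₀ a₃ * (HB b₂ b₃ * H b₀ a₂)) fun d =>
      mul_le_mul (hA' _ _) (mul_le_mul (hB _ _) (h _ _) (by positivity) (nB _ _))
        (by positivity) (nA _ _)).trans ?_
    simp only [← Finset.mul_expect, ← Finset.expect_mul, Fintype.expect_const]
    refine (mul_le_mul eA (mul_le_mul eB e p (by positivity)) (mul_nonneg pB p)
      (by positivity)).trans_eq ?_
    ring
  -- measured: copies 0, 1
  · obtain ⟨H, n, h, p, e, c⟩ :=
      (basisAverageBounded_bilinear (fs NA) (fr NA) (hmul hR hR1)).exists_majorant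
    simp only [Matrix.mulVec_mulVec] at h ⊢
    refine (sum_recordProb_mul_le hρ (fun a₀ b₀ a₁ b₁ a₂ b₂ a₃ b₃ =>
      H a₁ a₀ * HB b₀ b₁) fun d =>
      mul_le_mul (h _ _) (hB _ _) (by positivity) (n _ _)).trans ?_
    simp only [← Finset.mul_expect, ← Finset.expect_mul, Fintype.expect_const, c]
    refine (mul_le_mul e eB pB
      (by positivity)).trans_eq ?_
    ring
  -- measured: copies 0, 1, 3
  · obtain ⟨H, n, h, p, e, c⟩ :=
      (basisAverageBounded_bilinear (fs NA) (fs NB) hR).exists_majorant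
    refine (sum_recordProb_mul_le hρ (fun a₀ b₀ a₁ b₁ a₂ b₂ a₃ b₃ =>
      HA a₀ a₃ * (H a₁ b₃ * HB b₀ b₁)) fun d =>
      mul_le_mul (hA' _ _) (mul_le_mul (h _ _) (hB _ _) (by positivity) (n _ _))
        (by positivity) (nA _ _)).trans ?_
    simp only [← Finset.mul_expect, ← Finset.expect_mul, Fintype.expect_const]
    refine (mul_le_mul eA (mul_le_mul e eB pB (by positivity)) (mul_nonneg p pB)
      (by positivity)).trans_eq ?_
    ring
  -- measured: copies 0, 1, 2
  · obtain ⟨H, n, h, p, e, c⟩ :=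
      (basisAverageBounded_bilinear (fr NB) (fr NA) hR1).exists_majorant
    refine (sum_recordProb_mul_le hρ (fun a₀ b₀ a₁ b₁ a₂ b₂ a₃ b₃ =>
      H b₂ a₀ * (HA a₂ a₁ * HB b₀ b₁)) fun d =>
      mul_le_mul (h _ _) (mul_le_mul (hA' _ _) (hB _ _) (by positivity) (nA _ _))
        (by positivity) (n _ _)).trans ?_
    simp only [← Finset.mul_expect, ← Finset.expect_mul, Fintype.expect_const, cA, c]
    refine (mul_le_mul e (mul_le_mul eA eB pB (by positivity)) (mul_nonneg pA pB)
      (by positivity)).trans_eq ?_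
    ring
  -- measured: all copies
  · refine (sum_recordProb_mul_le hρ (fun a₀ b₀ a₁ b₁ a₂ b₂ a₃ b₃ =>
      HA a₀ a₃ * (HB b₂ b₃ * (HA a₂ a₁ * HB b₀ b₁))) fun d =>
      mul_le_mul (hA' _ _) (mul_le_mul (hB _ _) (mul_le_mul (hA' _ _) (hB _ _)
        (by positivity) (nA _ _)) (by positivity) (nB _ _)) (by positivity) (nA _ _)).trans ?_
    simp only [← Finset.mul_expect, ← Finset.expect_mul, cA]
    refine (mul_le_mul eA (mul_le_mul eB (mul_le_mul eA eB pB (by positivity))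
      (mul_nonneg pA pB) (by positivity)) (mul_nonneg pB (mul_nonneg pA pB))
     
      (by positivity)).trans_eq ?_
    ring

theorem sum_normSq_cyclicTrace_le {NA NB : ℕ} {ρ : Matrix (BitsAB NA NB) (BitsAB NA NB) ℂ}
    (hρ : IsDensityMatrix ρ) {T : Fin 4 → Bool} (hT : ∃ i, T i = true) :
    ∑ d : Fin 4 → Record NA NB, (∏ i, recordProb ρ (d i)) *
        ‖cyclicTrace fun i => realign (if T i then shadow (d i) else ρ)‖ ^ 2
      ≤ ∏ i, if T i then 3 ^ (NA + NB) else 1 := by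
  obtain ⟨j, hj⟩ := hT
  obtain ⟨κ, hκ, hM⟩ := exists_perm_norm_cyclicTrace (U := Bits NA × Bits NA)
    (W := Bits NB × Bits NB) j
  have h := sum_normSq_cyclicTrace_le_of_zero hρ (T := fun i => T (κ i)) (by rw [hκ, hj])
  rw [Equiv.prod_comp κ fun i => if T i then (3 : ℝ) ^ (NA + NB) else 1] at h
  refine le_trans (le_of_eq ?_) h
  rw [← (κ.arrowCongr (Equiv.refl (Record NA NB))).sum_comp]
  refine Finset.sum_congr rfl fun d _ => ?_
  rw [← hM, ← Equiv.prod_comp κ]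
  simp

/-! ### The variance of the estimator -/

/-- The real multilinear form `X ↦ Re Tr (𝒮 ⨂ i, X i)`. -/
noncomputable def traceForm (NA NB : ℕ) :
    MultilinearMap ℝ (fun _ : Fin 4 => Matrix (BitsAB NA NB) (BitsAB NA NB) ℂ) ℝ :=
  Complex.reLm.compMultilinearMap
    ((∑ x, ∑ y, opS NA NB x y • (MultilinearMap.mkPiAlgebra ℂ (Fin 4) ℂ).compLinearMap
      fun c => Matrix.entryLinearMap ℂ ℂ (y c) (x c)).restrictScalars ℝ)

theorem traceForm_apply {NA NB : ℕ} (X : Fin 4 → Matrix (BitsAB NA NB) (BitsAB NA NB) ℂ) :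
    traceForm NA NB X = (opS NA NB * tensor X).trace.re := by
  simp [traceForm, Matrix.trace, Matrix.mul_apply, tensor]

/-- The symmetrization of `traceForm`, which is the estimator as a function of the four batches. -/
noncomputable def symmTraceForm (NA NB : ℕ) :
    MultilinearMap ℝ (fun _ : Fin 4 => Matrix (BitsAB NA NB) (BitsAB NA NB) ℂ) ℝ :=
  (1 / (Nat.factorial 4 : ℝ)) • ∑ σ : Equiv.Perm (Fin 4), (traceForm NA NB).domDomCongr σ

theorem symmTraceForm_apply {NA NB : ℕ} (X : Fin 4 → Matrix (BitsAB NA NB) (BitsAB NA NB) ℂ) :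
    symmTraceForm NA NB X = (1 / (Nat.factorial 4 : ℝ)) * ∑ σ : Equiv.Perm (Fin 4),
      (opS NA NB * tensor fun i => X (σ i)).trace.re := by
  simp [symmTraceForm, traceForm_apply]

theorem symmTraceForm_const {NA NB : ℕ} (ρ : Matrix (BitsAB NA NB) (BitsAB NA NB) ℂ) :
    symmTraceForm NA NB (fun _ => ρ) = X4 ρ := by
  rw [symmTraceForm_apply, Finset.sum_const, Finset.card_univ, Fintype.card_perm, Fintype.card_fin,
    nsmul_eq_mul, ← mul_assoc, one_div_mul_cancel (by positivity), one_mul]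
  rfl

theorem sq_symmTraceForm_le {NA NB : ℕ} {X : Fin 4 → Matrix (BitsAB NA NB) (BitsAB NA NB) ℂ}
    (hX : ∀ i, (X i).IsHermitian) :
    symmTraceForm NA NB X ^ 2 ≤ (1 / (Nat.factorial 4 : ℝ)) * ∑ σ : Equiv.Perm (Fin 4),
      ‖cyclicTrace fun i => realign (X (σ i))‖ ^ 2 := by
  have hcard : ((Finset.univ : Finset (Equiv.Perm (Fin 4))).card : ℝ) = Nat.factorial 4 := by
    rw [Finset.card_univ, Fintype.card_perm, Fintype.card_fin]
  have h := sq_sum_le_card_mul_sum_sq (s := (Finset.univ : Finset (Equiv.Perm (Fin 4))))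
    (f := fun σ => (opS NA NB * tensor fun i => X (σ i)).trace.re)
  rw [hcard] at h
  have h' : ∑ σ : Equiv.Perm (Fin 4), (opS NA NB * tensor fun i => X (σ i)).trace.re ^ 2
      ≤ ∑ σ : Equiv.Perm (Fin 4), ‖cyclicTrace fun i => realign (X (σ i))‖ ^ 2 := by
    refine Finset.sum_le_sum fun σ _ => ?_
    rw [← trace_opS_mul_tensor fun i => hX (σ i)]
    exact sq_le_sq' (neg_le_of_abs_le (Complex.abs_re_le_norm _)) (Complex.re_le_norm _)
  have hpos : (0 : ℝ) < Nat.factorial 4 := by positivity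
  rw [symmTraceForm_apply, mul_pow]
  calc _ ≤ (1 / (Nat.factorial 4 : ℝ)) ^ 2 * (Nat.factorial 4 * ∑ σ : Equiv.Perm (Fin 4),
      ‖cyclicTrace fun i => realign (X (σ i))‖ ^ 2) := by
        gcongr
        exact h.trans (by gcongr)
    _ = _ := by
        field_simp

theorem sum_normSq_cyclicTrace_perm_le {NA NB : ℕ}
    {ρ : Matrix (BitsAB NA NB) (BitsAB NA NB) ℂ} (hρ : IsDensityMatrix ρ) {T : Fin 4 → Bool}
    (hT : ∃ i, T i = true) (σ : Equiv.Perm (Fin 4)) :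
    ∑ d : Fin 4 → Record NA NB, (∏ i, recordProb ρ (d i)) *
        ‖cyclicTrace fun i => realign (if T (σ i) then shadow (d (σ i)) else ρ)‖ ^ 2
      ≤ ∏ i, if T i then 3 ^ (NA + NB) else 1 := by
  have h := sum_normSq_cyclicTrace_le hρ (T := fun i => T (σ i))
    (hT.imp' σ.symm fun i hi => by simpa using hi)
  rw [Equiv.prod_comp σ fun i => if T i then (3 : ℝ) ^ (NA + NB) else 1] at h
  refine le_trans (le_of_eq ?_) h
  rw [← (σ.arrowCongr (Equiv.refl (Record NA NB))).sum_comp]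
  refine Finset.sum_congr rfl fun d _ => ?_
  rw [← Equiv.prod_comp σ]
  simp

theorem sum_sq_symmTraceForm_le {NA NB : ℕ} {ρ : Matrix (BitsAB NA NB) (BitsAB NA NB) ℂ}
    (hρ : IsDensityMatrix ρ) {T : Fin 4 → Bool} (hT : ∃ i, T i = true) :
    ∑ d : Fin 4 → Record NA NB, (∏ i, recordProb ρ (d i)) *
        symmTraceForm NA NB (fun i => if T i then shadow (d i) else ρ) ^ 2
      ≤ ∏ i, if T i then 3 ^ (NA + NB) else 1 := by
  have hherm (d : Fin 4 → Record NA NB) (i : Fin 4) :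
      (if T i then shadow (d i) else ρ).IsHermitian := by
    split_ifs
    exacts [shadow_isHermitian _, hρ.posSemidef.isHermitian]
  have h1 := Finset.sum_le_sum fun (d : Fin 4 → Record NA NB) (_ : d ∈ Finset.univ) =>
    mul_le_mul_of_nonneg_left (sq_symmTraceForm_le (hherm d))
      (Finset.prod_nonneg (s := Finset.univ) fun i _ => recordProb_nonneg hρ.posSemidef (d i))
  refine h1.trans ?_
  have hcard : ((Finset.univ : Finset (Equiv.Perm (Fin 4))).card : ℝ) = Nat.factorial 4 := by
    rw [Finset.card_univ, Fintype.card_perm, Fintype.card_fin]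
  have hpos : (0 : ℝ) < Nat.factorial 4 := by positivity
  generalize (Nat.factorial 4 : ℝ) = c at hcard hpos
  have h2 := Finset.sum_le_sum fun (σ : Equiv.Perm (Fin 4)) (_ : σ ∈ Finset.univ) =>
    sum_normSq_cyclicTrace_perm_le hρ hT σ
  rw [Finset.sum_const, nsmul_eq_mul, hcard, Finset.sum_comm] at h2
  simp only [mul_left_comm _ (1 / c), ← Finset.mul_sum] at h2 ⊢
  rw [one_div, inv_mul_le_iff₀ hpos]
  exact h2

theorem sum_bool_prod (x y : ℝ) :
    ∑ T : Fin 4 → Bool, ∏ i, (if T i then x else y) = (x + y) ^ 4 := by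
  rw [← Fintype.prod_sum fun (_ : Fin 4) (b : Bool) => if b then x else y]
  simp

/-- The second moment of the estimator, with the bound of `sum_sq_symmTraceForm_le` for each
nonempty set of slots filled by shadows. The empty set contributes at most `X₄ ^ 2`. -/
theorem sum_sq_batch_le {NA NB : ℕ} {ρ : Matrix (BitsAB NA NB) (BitsAB NA NB) ℂ}
    (hρ : IsDensityMatrix ρ) {K : ℕ} (hK : 0 < K) :
    ∑ z : Fin 4 → Fin K → Record NA NB, (∏ i, ∏ k, recordProb ρ (z i k)) *
        symmTraceForm NA NB (fun i => (K : ℝ)⁻¹ • ∑ k, shadow (z i k)) ^ 2 - X4 ρ ^ 2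
      ≤ (1 + (K : ℝ)⁻¹ * 3 ^ (NA + NB)) ^ 4 - 1 := by
  rw [sum_sq_multilinear_batch (sum_recordProb hρ.trace_eq_one) shadow hK,
    sum_recordProb_smul_shadow hρ.posSemidef.isHermitian]
  set α : ℝ := (K : ℝ)⁻¹
  set C : ℝ := 3 ^ (NA + NB)
  have hα0 : 0 ≤ α := by positivity
  have hα1 : α ≤ 1 := inv_le_one_of_one_le₀ (by exact_mod_cast hK)
  have hC : 0 ≤ C := by positivity
  set F : Fin 4 → Bool := fun _ => false
  have hF : ∑ d : Fin 4 → Record NA NB, (∏ i, recordProb ρ (d i)) *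
      symmTraceForm NA NB (fun i => if F i then shadow (d i) else ρ) ^ 2 = X4 ρ ^ 2 := by
    simp only [F, Bool.false_eq_true, if_false, symmTraceForm_const, ← Finset.sum_mul,
      (iid_sum_moments (sum_recordProb hρ.trace_eq_one) (fun _ => 0) 4).1, one_mul]
  have hsum := sum_bool_prod (α * C) (1 - α)
  rw [← Finset.add_sum_erase _ _ (Finset.mem_univ F)] at hsum ⊢
  rw [hF]
  have hle : ∑ T ∈ Finset.univ.erase F, (∏ i, if T i then α else 1 - α) *
        ∑ d : Fin 4 → Record NA NB, (∏ i, recordProb ρ (d i)) *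
          symmTraceForm NA NB (fun i => if T i then shadow (d i) else ρ) ^ 2
      ≤ ∑ T ∈ Finset.univ.erase F, ∏ i, if T i then α * C else 1 - α := by
    refine Finset.sum_le_sum fun T hT => ?_
    have hT' : ∃ i, T i = true := by
      by_contra! h
      exact Finset.ne_of_mem_erase hT (funext fun i => by simpa using h i)
    calc _ ≤ (∏ i, if T i then α else 1 - α) * ∏ i, if T i then C else 1 := by
          refine mul_le_mul_of_nonneg_left (sum_sq_symmTraceForm_le hρ hT') ?_
          refine Finset.prod_nonneg fun i _ => ?_
          split_ifs <;> linarith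
      _ = _ := by
          rw [← Finset.prod_mul_distrib]
          refine Finset.prod_congr rfl fun i _ => ?_
          split_ifs <;> simp
  simp only [F, Bool.false_eq_true, if_false, Finset.prod_const, Finset.card_univ,
    Fintype.card_fin] at hsum hle ⊢
  have hβ : (1 - α) ^ 4 ≤ 1 := pow_le_one₀ (by linarith) (by linarith)
  -- `(c + β) ^ 4 - β ^ 4` is monotone in `β`
  have hmono : (α * C + (1 - α)) ^ 4 - (1 - α) ^ 4 ≤ (1 + α * C) ^ 4 - 1 := by
    have hc : 0 ≤ α * C := by positivity
    generalize α * C = c at hc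
    have h1 : 0 ≤ 1 - α := by linarith
    have h2 : 1 - α ≤ 1 := by linarith
    generalize 1 - α = β at h1 h2
    have e1 := mul_le_mul_of_nonneg_left h2 (show 0 ≤ 4 * c ^ 3 by positivity)
    have e2 := mul_le_mul_of_nonneg_left (pow_le_one₀ (n := 2) h1 h2)
      (show 0 ≤ 6 * c ^ 2 by positivity)
    have e3 := mul_le_mul_of_nonneg_left (pow_le_one₀ (n := 3) h1 h2)
      (show 0 ≤ 4 * c by positivity)
    linarith [show (c + β) ^ 4 - β ^ 4 = c ^ 4 + 4 * c ^ 3 * β + 6 * c ^ 2 * β ^ 2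
      + 4 * c * β ^ 3 by ring, show (1 + c) ^ 4 - 1 = c ^ 4 + 4 * c ^ 3 * 1 + 6 * c ^ 2 * 1
      + 4 * c * 1 by ring]
  nlinarith [mul_le_mul_of_nonneg_right hβ (sq_nonneg (X4 ρ))]

/-! ### Samples of measurement records -/

section Sample

variable {NA NB M : ℕ} {ρ : Matrix (BitsAB NA NB) (BitsAB NA NB) ℂ} {Ω : Type*}
  [MeasurableSpace Ω] {μ : Measure Ω} {D : Fin M → Ω → Record NA NB}

theorem IsPauliSample.measurable_pi (hD : IsPauliSample ρ μ D) :
    Measurable fun ω r => D r ω :=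
  measurable_pi_lambda _ hD.measurable

theorem IsPauliSample.integral_eq [IsProbabilityMeasure μ] (hD : IsPauliSample ρ μ D)
    (φ : (Fin M → Record NA NB) → ℝ) :
    ∫ ω, φ (fun r => D r ω) ∂μ = ∑ d, (∏ r, recordProb ρ (d r)) * φ d := by
  have := Measure.isProbabilityMeasure_map (μ := μ) hD.measurable_pi.aemeasurable
  rw [← integral_map (φ := fun ω r => D r ω) hD.measurable_pi.aemeasurable
    (Measurable.of_discrete (f := φ)).aestronglyMeasurable, integral_fintype Integrable.of_finite]
  refine Finset.sum_congr rfl fun d _ => ?_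
  rw [smul_eq_mul]
  congr 1
  rw [map_measureReal_apply hD.measurable_pi (measurableSet_singleton d)]
  have h := hD.indep.measure_inter_preimage_eq_mul Finset.univ (sets := fun r => {d r})
    fun r _ => measurableSet_singleton _
  have e : (fun ω r => D r ω) ⁻¹' {d} = ⋂ r ∈ Finset.univ, D r ⁻¹' {d r} := by
    ext ω
    simp [funext_iff]
  rw [e, measureReal_def, h, ENNReal.toReal_prod]
  exact Finset.prod_congr rfl fun r _ => hD.law r (d r)

theorem IsPauliSample.memLp [IsProbabilityMeasure μ] (hD : IsPauliSample ρ μ D)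
    (φ : (Fin M → Record NA NB) → ℝ) : MemLp (fun ω => φ fun r => D r ω) 2 μ := by
  have := Measure.isProbabilityMeasure_map (μ := μ) hD.measurable_pi.aemeasurable
  have h : MemLp φ 2 (μ.map fun ω r => D r ω) := MemLp.of_discrete
  exact h.comp_of_map hD.measurable_pi.aemeasurable

end Sample

theorem batch_eq {NA NB K : ℕ} (d : Fin (4 * K) → Record NA NB) (b : Fin 4) :
    batch d b = (K : ℝ)⁻¹ • ∑ k, shadow (d (finProdFinEquiv (b, k))) := by
  have hc : (4 : ℂ) / ((4 * K : ℕ) : ℂ) = (((K : ℝ)⁻¹ : ℝ) : ℂ) := by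
    push_cast
    rw [div_mul_eq_div_div, div_self (by norm_num), one_div]
  rw [batch, hc, Nat.mul_div_cancel_left K (by norm_num), Complex.coe_smul]
  congr 1
  rw [Finset.sum_filter, ← finProdFinEquiv.sum_comp, Fintype.sum_prod_type,
    Finset.sum_eq_single b]
  · refine Finset.sum_congr rfl fun k _ => if_pos ?_
    have := k.isLt
    simp only [finProdFinEquiv_apply_val]
    constructor <;> nlinarith
  · intro b' _ hb
    refine Finset.sum_eq_zero fun k _ => if_neg ?_
    have hk := k.isLt
    simp only [finProdFinEquiv_apply_val]
    rintro ⟨h1, h2⟩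
    refine hb (Fin.ext (le_antisymm ?_ ?_))
    · by_contra! hlt
      nlinarith
    · by_contra! hlt
      nlinarith
  · simp

theorem X4est_eq {NA NB K : ℕ} (d : Fin (4 * K) → Record NA NB) :
    X4est d = symmTraceForm NA NB fun b =>
      (K : ℝ)⁻¹ • ∑ k, shadow (d (finProdFinEquiv (b, k))) := by
  simp only [symmTraceForm_apply, X4est, batch_eq]

theorem sum_runs_eq {NA NB K : ℕ} (p : Record NA NB → ℝ)
    (φ : (Fin 4 → Fin K → Record NA NB) → ℝ) :
    ∑ d : Fin (4 * K) → Record NA NB, (∏ r, p (d r))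
        * φ (fun b k => d (finProdFinEquiv (b, k)))
      = ∑ z : Fin 4 → Fin K → Record NA NB, (∏ b, ∏ k, p (z b k)) * φ z := by
  rw [← ((Equiv.curry (Fin 4) (Fin K) (Record NA NB)).symm.trans
    (finProdFinEquiv.arrowCongr (Equiv.refl _))).sum_comp]
  refine Finset.sum_congr rfl fun z _ => ?_
  rw [← finProdFinEquiv.prod_comp, Fintype.prod_prod_type]
  simp [Function.uncurry]

section Estimator

variable {NA NB K : ℕ} {ρ : Matrix (BitsAB NA NB) (BitsAB NA NB) ℂ} {Ω : Type*}
  [MeasurableSpace Ω] {μ : Measure Ω} [IsProbabilityMeasure μ]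
  {D : Fin (4 * K) → Ω → Record NA NB}

/-- The estimator is unbiased. -/
theorem integral_X4est (hρ : IsDensityMatrix ρ) (hK : 0 < K) (hD : IsPauliSample ρ μ D) :
    ∫ ω, X4est (fun r => D r ω) ∂μ = X4 ρ := by
  rw [hD.integral_eq]
  simp only [X4est_eq]
  rw [sum_runs_eq (recordProb ρ) fun z => symmTraceForm NA NB fun b =>
      (K : ℝ)⁻¹ • ∑ k, shadow (z b k),
    sum_multilinear_batch (sum_recordProb hρ.trace_eq_one) shadow hK,
    sum_recordProb_smul_shadow hρ.posSemidef.isHermitian, symmTraceForm_const]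

theorem variance_X4est_le (hρ : IsDensityMatrix ρ) (hK : 0 < K) (hD : IsPauliSample ρ μ D) :
    variance (fun ω => X4est fun r => D r ω) μ ≤ (1 + (K : ℝ)⁻¹ * 3 ^ (NA + NB)) ^ 4 - 1 := by
  rw [variance_eq_sub (hD.memLp X4est), integral_X4est hρ hK hD]
  refine le_trans (le_of_eq ?_) (sum_sq_batch_le hρ hK)
  congr 1
  simp only [Pi.pow_apply]
  rw [hD.integral_eq fun d => X4est d ^ 2]
  simp only [X4est_eq]
  rw [sum_runs_eq (recordProb ρ) fun z => (symmTraceForm NA NB fun b =>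
      (K : ℝ)⁻¹ • ∑ k, shadow (z b k)) ^ 2]

end Estimator

/-! ### The number of measurements -/

theorem rpow_quarter_sub_one_pos {x : ℝ} (hx : 0 < x) : 0 < (1 + x) ^ ((1 : ℝ) / 4) - 1 :=
  sub_pos.mpr (Real.one_lt_rpow (by linarith) (by norm_num))

/-- Bernoulli's inequality, `(1 + x) ^ (1 / 4) - 1 ≤ x / 4`. -/
theorem div_le_sample_bound {c x : ℝ} (hc : 0 ≤ c) (hx : 0 < x) :
    16 * c / x ≤ 4 * c / ((1 + x) ^ ((1 : ℝ) / 4) - 1) := by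
  have h := rpow_one_add_le_one_add_mul_self (s := x) (by linarith) (p := 1 / 4)
    (by norm_num) (by norm_num)
  rw [div_le_div_iff₀ hx (rpow_quarter_sub_one_pos hx)]
  nlinarith

theorem isEquivalent_sample_bound {c : ℝ} (hc : 0 < c) :
    Asymptotics.IsEquivalent (nhdsWithin 0 (Set.Ioi 0))
      (fun x : ℝ => 4 * c / ((1 + x) ^ ((1 : ℝ) / 4) - 1)) (fun x : ℝ => 16 * c / x) := by
  have hd : HasDerivAt (fun x : ℝ => (1 + x) ^ ((1 : ℝ) / 4)) (1 / 4) 0 := by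
    have h := ((hasDerivAt_id (0 : ℝ)).const_add 1).rpow_const (p := 1 / 4) (by simp)
    simpa using h
  have hs := (hasDerivAt_iff_tendsto_slope.mp hd).mono_left
    (nhdsWithin_mono (0 : ℝ) (t := {0}ᶜ) (s := Set.Ioi 0) fun x hx => ne_of_gt hx)
  have hlim : Filter.Tendsto (fun x => (4 * slope (fun x : ℝ => (1 + x) ^ ((1 : ℝ) / 4)) 0 x)⁻¹)
      (nhdsWithin 0 (Set.Ioi 0)) (nhds 1) := by
    simpa using (hs.const_mul 4).inv₀ (by norm_num)
  rw [Asymptotics.isEquivalent_iff_tendsto_one]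
  · refine hlim.congr' ?_
    filter_upwards [self_mem_nhdsWithin] with x hx
    have hx' : (0 : ℝ) < x := hx
    have h1 := (rpow_quarter_sub_one_pos hx').ne'
    simp only [slope_def_field, Pi.div_apply, add_zero, Real.one_rpow, sub_zero]
    field_simp
    norm_num
  · filter_upwards [self_mem_nhdsWithin] with x hx
    have hx' : (0 : ℝ) < x := hx
    positivity

end BatchShadow

theorem proposition3 (NA NB : ℕ)
    (ρ : Matrix (BatchShadow.BitsAB NA NB) (BatchShadow.BitsAB NA NB) ℂ)
    (hρ : BatchShadow.IsDensityMatrix ρ) :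
    -- variance bound and sufficient number of measurements
    (∀ (M : ℕ), 0 < M → 4 ∣ M →
      ∀ {Ω : Type*} [MeasurableSpace Ω] (μ : Measure Ω) [IsProbabilityMeasure μ]
        (D : Fin M → Ω → BatchShadow.Record NA NB), BatchShadow.IsPauliSample ρ μ D →
        MemLp (fun ω => BatchShadow.X4est fun r => D r ω) 2 μ ∧
        variance (fun ω => BatchShadow.X4est fun r => D r ω) μ
          ≤ (1 + 4 * 3 ^ (NA + NB) / (M : ℝ)) ^ 4 - 1 ∧
        ∀ ε δ : ℝ, 0 < ε → 0 < δ →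
          4 * 3 ^ (NA + NB) / ((1 + ε ^ 2 * δ) ^ ((1 : ℝ) / 4) - 1) ≤ (M : ℝ) →
          μ.real {ω | ε ≤ |(BatchShadow.X4est fun r => D r ω) - BatchShadow.X4 ρ|} ≤ δ) ∧
    -- that number is at least `16 * 3 ^ N / (ε ^ 2 * δ)`, and asymptotic to it for small `ε ^ 2 * δ`
    (∀ ε δ : ℝ, 0 < ε → 0 < δ →
      16 * 3 ^ (NA + NB) / (ε ^ 2 * δ)
        ≤ 4 * 3 ^ (NA + NB) / ((1 + ε ^ 2 * δ) ^ ((1 : ℝ) / 4) - 1)) ∧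
    Asymptotics.IsEquivalent (nhdsWithin 0 (Set.Ioi 0))
      (fun x : ℝ => 4 * 3 ^ (NA + NB) / ((1 + x) ^ ((1 : ℝ) / 4) - 1))
      (fun x : ℝ => 16 * 3 ^ (NA + NB) / x) := by
  refine ⟨fun M hM hdvd Ω _ μ _ D hD => ?_, fun ε δ hε hδ =>
    BatchShadow.div_le_sample_bound (by positivity) (by positivity),
    BatchShadow.isEquivalent_sample_bound (by positivity)⟩
  obtain ⟨K, rfl⟩ := hdvd
  have hK : 0 < K := by omega
  have hL2 := hD.memLp BatchShadow.X4est
  have hvar : variance (fun ω => BatchShadow.X4est fun r => D r ω) μ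
      ≤ (1 + 4 * 3 ^ (NA + NB) / ((4 * K : ℕ) : ℝ)) ^ 4 - 1 := by
    refine (BatchShadow.variance_X4est_le hρ hK hD).trans_eq ?_
    push_cast
    rw [mul_div_mul_left _ _ (by norm_num), div_eq_inv_mul]
  refine ⟨hL2, hvar, fun ε δ hε hδ hMε => ?_⟩
  have hx : 0 < ε ^ 2 * δ := by positivity
  have hpos := BatchShadow.rpow_quarter_sub_one_pos hx
  have hM' : (0 : ℝ) < ((4 * K : ℕ) : ℝ) := by exact_mod_cast hM
  have hroot : 1 + 4 * 3 ^ (NA + NB) / ((4 * K : ℕ) : ℝ)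
      ≤ (1 + ε ^ 2 * δ) ^ ((1 : ℝ) / 4) := by
    rw [← le_sub_iff_add_le', div_le_comm₀ hM' hpos]
    exact hMε
  have hle : variance (fun ω => BatchShadow.X4est fun r => D r ω) μ ≤ ε ^ 2 * δ := by
    have h4 : ((1 + ε ^ 2 * δ) ^ ((1 : ℝ) / 4)) ^ 4 = 1 + ε ^ 2 * δ := by
      rw [← Real.rpow_natCast, ← Real.rpow_mul (by positivity)]
      norm_num
    have := pow_le_pow_left₀ (by positivity) hroot 4
    linarith
  have hcheb := meas_ge_le_variance_div_sq hL2 hε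
  rw [BatchShadow.integral_X4est hρ hK hD] at hcheb
  rw [measureReal_def]
  refine (ENNReal.toReal_le_of_le_ofReal (div_nonneg (variance_nonneg _ _) (by positivity))
    hcheb).trans ?_
  rw [div_le_iff₀ (by positivity), mul_comm δ]
  exact hle
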